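/- Let $p\ge 1$ be an integer. For $h>0$ let $\theta_p^j$, $j\in\mathbb Z$, be the B-splines of degree $p$ on the uniform grid $x_i=ih$ of the real line, and set $A_p^{j+k}=h\int_{\mathbb R}(\theta_p^j)'(\theta_p^{j+k})'\,dx$ and $B_p^{j+k}=h^{-1}\int_{\mathbb R}\theta_p^j\theta_p^{j+k}\,dx$. For a quadrature rule $Q$ on $[0,1]$, with finitely many nodes in $[0,1]$ and real weights, let $a_Q(w,v)$ and $b_Q(w,v)$ be the bilinear forms obtained from $\int w'v'$ and $\int wv$ by applying $Q$, mapped affinely to $[x_e,x_{e+1}]$, on every element (derivatives being those of the restriction to the closed element), and set $\tilde A_{p,Q}^{j+k}=h\,a_Q(\theta_p^j,\theta_p^{j+k})$ and $\tilde B_{p,Q}^{j+k}=h^{-1}b_Q(\theta_p^j,\theta_p^{j+k})$. (None of these entries depends on $j$ or $h$.) Let $G_{p+1}$ be the $(p+1)$-point Gauss–Legendre rule on $[0,1]$. Let $Q_p$ be any quadrature rule that is exact for all polynomials of degree at most $2p-2$ and does not integrate the mass entries exactly, that is, $\tilde B_{p,Q_p}^{j+k}\ne B_p^{j+k}$ for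 some $k$. Then $$\sum_{k=1}^p\frac{k^{2p}}{(2p)!}\bigl(\tilde B_{p,Q_p}^{j+k}-B_p^{j+k}\bigr)\neq 0,$$ so that $$\tau=\frac{\sum_{k=1}^p\left(\frac{k^{2p+2}}{(2p+2)!}\tilde A_{p,Q_p}^{j+k}+\frac{k^{2p}}{(2p)!}\tilde B_{p,Q_p}^{j+k}\right)}{\sum_{k=1}^p\frac{k^{2p}}{(2p)!}\bigl(\tilde B_{p,Q_p}^{j+k}-B_p^{j+k}\bigr)}$$ is well defined. Let $Q_\tau=\tau G_{p+1}+(1-\tau)Q_p$. Then: 1. For $m=2,3,\dots,p+1$, $$\sum_{k=1}^p\left(\frac{k^{2m}}{(2m)!}\tilde A_{p,Q_\tau}^{j+k}+\frac{k^{2m-2}}{(2m-2)!}\tilde B_{p,Q_\tau}^{j+k}\right)=0 .$$ 2. Let $\mu\in\mathbb R$ and $\lambda=\mu^2$. For all sufficiently small $h>0$ there is exactly one real number $\tilde\lambda^h$ (the discrete eigenvalue that approximates $\lambda$) such that the Bloch wave $u^h=\sum_k e^{\mathrm i k\mu h}\theta_p^k$ satisfies $a_{Q_\tau}(\theta_p^i,u^h)=\tilde\lambda^h\,b_{Q_\tau}(\theta_p^i,u^h)$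 for all $i\in\mathbb Z$. As $h\to0^+$, with $\mu$ fixed, $$\tilde\lambda^h-\lambda=2(-1)^p\left(\sum_{k=1}^p\frac{k^{2p+4}}{(2p+4)!}A_p^{j+k}+\frac{k^{2p+2}}{(2p+2)!}\bigl(\tau B_p^{j+k}+(1-\tau)\tilde B_{p,Q_p}^{j+k}\bigr)\right)\mu^{2p+4}h^{2p+2}+\mathcal O(h^{2p+4}),$$ and in particular $\tilde\lambda^h-\lambda=\mathcal O(h^{2p+2})$. -/

import Mathlib

open Filter Topology

noncomputable section

namespace IGA

/-- The `j`-th B-spline basis function of degree `p` for the knots `x`, by the Cox–de Boor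
recursion. -/
def bspline (x : ℤ → ℝ) : ℕ → ℤ → ℝ → ℝ
  | 0, j, t => if x j ≤ t ∧ t < x (j + 1) then 1 else 0
  | p + 1, j, t =>
      (t - x j) / (x (j + (p + 1)) - x j) * bspline x p j t +
        (x (j + (p + 1) + 1) - t) / (x (j + (p + 1) + 1) - x (j + 1)) * bspline x p (j + 1) t

/-- The B-spline `θ_p^j` on the uniform grid `x_i = i h` of the real line. -/
def theta (p : ℕ) (h : ℝ) (j : ℤ) : ℝ → ℝ :=
  bspline (fun i => (i : ℝ) * h) p j

/-- The spline `∑_k U^k θ_p^k` (a locally finite sum). -/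
def spline (p : ℕ) (h : ℝ) (U : ℤ → ℂ) (t : ℝ) : ℂ :=
  ∑ᶠ k : ℤ, theta p h k t • U k

/-- A quadrature rule on the reference element `[0, 1]`, `∑_l w_l f(n_l)`, recorded as the finitely
supported function that takes the node `n_l` to its weight `w_l`. Rules are added and multiplied by
scalars weight by weight, so `τ • G + (1 - τ) • Q` is the blended rule. -/
abbrev QuadRule := ℝ →₀ ℝ

/-- The value `∑_l w_l f(n_l)` of a rule at `f`. -/
def QuadRule.apply {E : Type*} [AddCommGroup E] [Module ℝ E] (Q : QuadRule) (f : ℝ → E) : E :=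
  Finsupp.sum Q fun n w => w • f n

/-- The nodes lie in the reference element. -/
def QuadRule.NodesInElement (Q : QuadRule) : Prop :=
  ∀ n ∈ Finsupp.support Q, n ∈ Set.Icc (0 : ℝ) 1

/-- The rule integrates every polynomial of degree at most `d` exactly over `[0, 1]`. -/
def QuadRule.ExactTo (Q : QuadRule) (d : ℕ) : Prop :=
  ∀ f : Polynomial ℝ, f.natDegree ≤ d →
    QuadRule.apply Q (fun t => f.eval t) = ∫ t in (0 : ℝ)..1, f.eval t

/-- The nodes of the `m`-point Gauss–Legendre rule on `[0, 1]`: the zeros of the shifted Legendre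
polynomial of degree `m`. -/
def gaussNodes (m : ℕ) : Finset ℝ :=
  ((Polynomial.shiftedLegendre m).map (Int.castRingHom ℝ)).roots.toFinset

/-- The `m`-point Gauss–Legendre rule `G_m` on `[0, 1]`; its weights are the integrals of the
Lagrange basis polynomials of its nodes. -/
def gaussRule (m : ℕ) : QuadRule :=
  ∑ n ∈ gaussNodes m,
    Finsupp.single n (∫ t in (0 : ℝ)..1, (Lagrange.basis (gaussNodes m) id n).eval t)

/-- The blended rule `τ G_{p+1} + (1 - τ) Q`. -/
def blend (p : ℕ) (Q : QuadRule) (τ : ℝ) : QuadRule :=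
  τ • gaussRule (p + 1) + (1 - τ) • Q

/-- `a(w, v) = ∫ w' v'` on the real line. -/
def formA (w v : ℝ → ℝ) : ℝ := ∫ t, deriv w t * deriv v t

/-- `b(w, v) = ∫ w v` on the real line. -/
def formB (w v : ℝ → ℝ) : ℝ := ∫ t, w t * v t

/-- The `e`-th element of the uniform mesh of size `h`. -/
def element (h : ℝ) (e : ℤ) : Set ℝ := Set.Icc ((e : ℝ) * h) (((e : ℝ) + 1) * h)

/-- `a_h(w, v)`: the rule `Q` is applied to `w' v'` on every element. The derivatives are those of
the restrictions to the closed element, hence one-sided at its end points. -/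
def formAQ {E : Type*} [NormedAddCommGroup E] [NormedSpace ℝ E]
    (Q : QuadRule) (h : ℝ) (w : ℝ → ℝ) (v : ℝ → E) : E :=
  ∑ᶠ e : ℤ, h • QuadRule.apply Q fun n =>
    derivWithin w (element h e) (((e : ℝ) + n) * h) •
      derivWithin v (element h e) (((e : ℝ) + n) * h)

/-- `b_h(w, v)`: the rule `Q` is applied to `w v` on every element. -/
def formBQ {E : Type*} [NormedAddCommGroup E] [NormedSpace ℝ E]
    (Q : QuadRule) (h : ℝ) (w : ℝ → ℝ) (v : ℝ → E) : E :=
  ∑ᶠ e : ℤ, h • QuadRule.apply Q fun n =>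
    w (((e : ℝ) + n) * h) • v (((e : ℝ) + n) * h)

/-- The exact stiffness entry `A_p^{j+k} = a(θ_p^j, θ_p^{j+k}) h`. -/
def stiff (p : ℕ) (h : ℝ) (j k : ℤ) : ℝ :=
  formA (theta p h j) (theta p h (j + k)) * h

/-- The exact mass entry `B_p^{j+k} = b(θ_p^j, θ_p^{j+k}) / h`. -/
def mass (p : ℕ) (h : ℝ) (j k : ℤ) : ℝ :=
  formB (theta p h j) (theta p h (j + k)) / h

/-- The stiffness entry computed with the rule `Q`. -/
def stiffQ (p : ℕ) (Q : QuadRule) (h : ℝ) (j k : ℤ) : ℝ :=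
  formAQ Q h (theta p h j) (theta p h (j + k)) * h

/-- The mass entry computed with the rule `Q`. -/
def massQ (p : ℕ) (Q : QuadRule) (h : ℝ) (j k : ℤ) : ℝ :=
  formBQ Q h (theta p h j) (theta p h (j + k)) / h

/-- The numerator of the blending parameter. -/
def tauNum (p : ℕ) (Q : QuadRule) (h : ℝ) (j : ℤ) : ℝ :=
  ∑ k ∈ Finset.Icc 1 p,
    ((k : ℝ) ^ (2 * p + 2) / (Nat.factorial (2 * p + 2) : ℝ) * stiffQ p Q h j k +
      (k : ℝ) ^ (2 * p) / (Nat.factorial (2 * p) : ℝ) * massQ p Q h j k)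

/-- The denominator of the blending parameter. -/
def tauDen (p : ℕ) (Q : QuadRule) (h : ℝ) (j : ℤ) : ℝ :=
  ∑ k ∈ Finset.Icc 1 p,
    (k : ℝ) ^ (2 * p) / (Nat.factorial (2 * p) : ℝ) * (massQ p Q h j k - mass p h j k)

/-- The blending parameter `τ`. -/
def tau (p : ℕ) (Q : QuadRule) (h : ℝ) (j : ℤ) : ℝ :=
  tauNum p Q h j / tauDen p Q h j

/-- `(lam, U)` is an eigenpair of the discrete problem `K U = lam M U` of degree `p` on the uniform
grid of size `h`, both bilinear forms being computed with the rule `Q`. -/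
def IsEigenpair (p : ℕ) (Q : QuadRule) (h lam : ℝ) (U : ℤ → ℂ) : Prop :=
  U ≠ 0 ∧ ∀ i : ℤ,
    formAQ Q h (theta p h i) (spline p h U) =
      (lam : ℂ) * formBQ Q h (theta p h i) (spline p h U)

/-- The Bloch wave `U^j = e^{i j μ h}` of frequency `μ`. -/
def bloch (μ h : ℝ) (j : ℤ) : ℂ :=
  Complex.exp (Complex.I * ((j : ℂ) * (μ : ℂ) * (h : ℂ)))

/-- `lam` is the discrete eigenvalue that approximates `μ ^ 2`: it belongs to the Bloch wave of
frequency `μ`. -/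
def IsDiscreteEigenvalue (p : ℕ) (Q : QuadRule) (h μ lam : ℝ) : Prop :=
  IsEigenpair p Q h lam (bloch μ h)

/-- The coefficient of `μ ^ (2 p + 4) h ^ (2 p + 2)` in the eigenvalue error. -/
def errorCoeff (p : ℕ) (Q : QuadRule) (h : ℝ) (j : ℤ) : ℝ :=
  2 * (-1) ^ p * ∑ k ∈ Finset.Icc 1 p,
    ((k : ℝ) ^ (2 * p + 4) / (Nat.factorial (2 * p + 4) : ℝ) * stiff p h j k +
      (k : ℝ) ^ (2 * p + 2) / (Nat.factorial (2 * p + 2) : ℝ) *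
        (tau p Q h j * mass p h j k + (1 - tau p Q h j) * massQ p Q h j k))

end IGA

end

namespace IGA

open Polynomial

/-! Write `p = q + 1`. Applied to a Bloch wave with `s = μ h`, the translation-invariant discrete
equations all reduce to the scalar equation `A(s) = λ̃ h ^ 2 * B(s)`, where `A` and `B` are the
symbols of the stiffness and mass sequences of the rule. The accuracy of the eigenvalue is therefore
the order to which `A(s) - s ^ 2 * B(s)` vanishes at `s = 0`. Its Taylor coefficient at `(i s) ^ (r
+ 2)` is `defect L p r`; for even `r > 0` the sums in the theorem are half of these defects, and odd
defects vanish by symmetry.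

For exact integration, `A(s) - s ^ 2 * B(s)` is an energy of the exponential spline over one
element. Subtracting a multiple of `exp (i s x)`, which solves `u'' = -s ^ 2 u`, does not change
this energy. What is left is quadratic in a residual whose derivative is of order `s ^ (p + 1)`, so
the result is `O(s ^ (2 p + 2))` (`symbol_intFunctional_isBigO`) and the defects below order `2 p`
vanish.

A rule exact to degree `2 p - 2` leaves the stiffness unchanged. Its mass error involves only the
top two coefficients of products of pieces, and their generating functions are explicit; hence the
symbol of the mass error is a constant times `((1 - exp (i s)) * (1 - exp (-i s))) ^ p`
(`symbol_annihilates_piece`). This has order exactly `s ^ (2 p)` unless the constant is zero, in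
which case every mass entry is exact. So the moments of the error below order `2 p` vanish, and the
one of order `2 p`, essentially the denominator of `τ`, does not.

The Gauss rule with `p + 1` points reproduces both exact sequences, so the defect of the blend is
affine in `τ`, and the stated `τ` is the root of its defect of order `2 p`. The next nonzero term
has order `s ^ (2 p + 4)`; division by `h ^ 2 * B(s)`, with `B(s) = 1 + O(s ^ 2)`, gives the
eigenvalue expansion. -/

/-! ### Cardinal B-splines as families of polynomial pieces -/

/-- The polynomial that represents the cardinal B-spline of degree `p` on the element `[i, i + 1]`,
in the local variable of the element. -/
noncomputable def piece : ℕ → ℤ → ℝ[X]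
  | 0, i => if i = 0 then 1 else 0
  | p + 1, i => C ((p + 1 : ℝ)⁻¹) *
      ((X + C (i : ℝ)) * piece p i + (C (p + 2 - i : ℝ) - X) * piece p (i - 1))


lemma piece_succ_mul (p : ℕ) (i : ℤ) : C (p + 1 : ℝ) * piece (p + 1) i =
    (X + C (i : ℝ)) * piece p i + (C (p + 2 - i : ℝ) - X) * piece p (i - 1) := by
  rw [piece, ← mul_assoc, ← C_mul, mul_inv_cancel₀ (by positivity), C_1, one_mul]

lemma piece_eq_zero {p : ℕ} {i : ℤ} (hi : i < 0 ∨ (p : ℤ) < i) : piece p i = 0 := by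
  induction p generalizing i with
  | zero => rw [piece, if_neg (by rintro rfl; simp at hi)]
  | succ p ih =>
    rw [piece, ih (by push_cast at hi; omega), ih (by push_cast at hi; omega)]; simp

lemma natDegree_piece_le (p : ℕ) (i : ℤ) : (piece p i).natDegree ≤ p := by
  induction p generalizing i with
  | zero => rw [piece]; split_ifs <;> simp
  | succ p ih =>
    rw [piece]
    refine (natDegree_C_mul_le _ _).trans (natDegree_add_le_of_degree_le ?_ ?_)
    · refine natDegree_mul_le.trans ?_
      rw [natDegree_X_add_C]; have := ih i; omega
    · refine natDegree_mul_le.trans ?_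
      have h1 : (C (p + 2 - i : ℝ) - X).natDegree ≤ 1 :=
        (natDegree_sub_le _ _).trans (by rw [natDegree_C, natDegree_X]; simp)
      have := ih (i - 1); omega

/-- Differentiate the recursion and insert the induction hypothesis. Apart from the two terms from
the derivative of the linear factors, what appears is the difference of the recursions one degree
lower at `i` and at `i - 1`. -/
lemma derivative_piece_succ (p : ℕ) (i : ℤ) :
    derivative (piece (p + 1) i) = piece p i - piece p (i - 1) := by
  induction p generalizing i with
  | zero =>
    have h := congrArg derivative (piece_succ_mul 0 i)
    have hd : ∀ k, derivative (piece 0 k) = 0 := fun k => by rw [piece]; split_ifs <;> simp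
    simp only [derivative_mul, derivative_add, derivative_sub, derivative_C, derivative_X, hd] at h
    simpa [sub_eq_add_neg] using h
  | succ p ih =>
    have h := congrArg derivative (piece_succ_mul (p + 1) i)
    have e1 := piece_succ_mul p i
    have e2 := piece_succ_mul p (i - 1)
    simp only [derivative_mul, derivative_add, derivative_sub, derivative_C, derivative_X, ih] at h
    have hc : (C ((p + 1 : ℕ) + 1 : ℝ) : ℝ[X]) ≠ 0 := by
      rw [Ne, C_eq_zero]; positivity
    apply mul_left_cancel₀ hc
    push_cast at h e1 e2 ⊢
    simp only [map_add, map_sub, map_one, map_natCast, map_intCast, C_ofNat] at h e1 e2 ⊢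
    linear_combination h - e1 + e2

/-- Continuity of the B-spline across a knot, which starts at degree one because the degree-zero
spline jumps. -/
lemma eval_one_piece (p : ℕ) (i : ℤ) :
    (piece (p + 1) i).eval 1 = (piece (p + 1) (i + 1)).eval 0 := by
  induction p generalizing i with
  | zero =>
    have h0 : ∀ (k : ℤ) (x : ℝ), (piece 0 k).eval x = if k = 0 then 1 else 0 := fun k x => by
      rw [piece]; split_ifs <;> simp
    simp only [piece.eq_2, eval_mul, eval_add, eval_sub, eval_C, eval_X, h0, add_sub_cancel_right]
    by_cases h : i = 0
    · subst h; norm_num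
    · by_cases h' : i = 1
      · subst h'; norm_num
      · by_cases h'' : i = -1
        · subst h''; norm_num
        · rw [if_neg h, if_neg (by omega), if_neg (by omega)]; simp
  | succ p ih =>
    rw [piece.eq_2 i (p + 1), piece.eq_2 (i + 1) (p + 1), add_sub_cancel_right]
    simp only [eval_mul, eval_add, eval_sub, eval_C, eval_X, ih, sub_add_cancel]
    push_cast
    ring

/-- Telescoping of a generating function. -/
lemma sum_sub_shift_mul_pow {K : Type*} [CommRing K] (g : ℤ → K) (n : ℕ) (z : K)
    (h0 : g (-1) = 0) (h1 : g (n + 1 : ℕ) = 0) :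
    ∑ i ∈ Finset.range (n + 2), (g i - g (i - 1)) * z ^ i =
      (1 - z) * ∑ i ∈ Finset.range (n + 1), g i * z ^ i := by
  simp only [sub_mul, Finset.sum_sub_distrib]
  rw [Finset.sum_range_succ, h1, Finset.sum_range_succ' (fun i : ℕ => g ((i : ℤ) - 1) * z ^ i)]
  simp only [Nat.cast_zero, zero_sub, h0, one_mul, zero_mul, add_zero, Finset.mul_sum]
  congr 1
  refine Finset.sum_congr rfl fun i _ => ?_
  push_cast
  rw [add_sub_cancel_right]; ring

/-- Partition of unity: after a shift of the second sum, the two linear factors that multiply the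
same piece add up to `p + 1`. -/
lemma sum_piece (p : ℕ) : ∑ i ∈ Finset.range (p + 1), piece p i = 1 := by
  induction p with
  | zero => simp [piece]
  | succ p ih =>
    have e : ∑ i ∈ Finset.range (p + 2), C (p + 1 : ℝ) * piece (p + 1) i =
        C (p + 1 : ℝ) * ∑ i ∈ Finset.range (p + 1), piece p i := by
      simp only [piece_succ_mul, Finset.sum_add_distrib]
      rw [Finset.sum_range_succ,
        Finset.sum_range_succ' (fun i : ℕ => (C (p + 2 - (i : ℤ) : ℝ) - X) * piece p ((i : ℤ) - 1))]
      rw [piece_eq_zero (i := ((p + 1 : ℕ) : ℤ)) (by simp), piece_eq_zero (i := ((0 : ℕ) : ℤ) - 1) (by simp)]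
      rw [mul_zero, mul_zero, add_zero, add_zero, ← Finset.sum_add_distrib, Finset.mul_sum]
      refine Finset.sum_congr rfl fun i _ => ?_
      push_cast
      rw [add_sub_cancel_right]
      simp only [map_add, map_sub, map_one, map_natCast, C_ofNat]
      ring
    rw [ih, ← Finset.mul_sum] at e
    exact mul_left_cancel₀ (by rw [Ne, C_eq_zero]; positivity) e

/-! ### Correlation sequences, their entries, moments and symbols -/

section Correlation

variable {E : Type*} [AddCommGroup E] [Module ℝ E]

/-- The correlation `∑ m l, L (F m * F l) • U (m - l)` of the first `p + 1` members of a family of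
polynomials with respect to a linear functional. -/
noncomputable def corr (L : ℝ[X] →ₗ[ℝ] ℝ) (p : ℕ) (F : ℤ → ℝ[X]) (U : ℤ → E) : E :=
  ∑ m ∈ Finset.range (p + 1), ∑ l ∈ Finset.range (p + 1), L (F m * F l) • U (m - l)

/-- The moments of the correlation sequence. -/
noncomputable def moment (L : ℝ[X] →ₗ[ℝ] ℝ) (p : ℕ) (F : ℤ → ℝ[X]) (r : ℕ) : ℝ :=
  corr L p F fun k => (k : ℝ) ^ r

/-- The symbol of the correlation sequence. -/
noncomputable def symbol (L : ℝ[X] →ₗ[ℝ] ℝ) (p : ℕ) (F : ℤ → ℝ[X]) (s : ℝ) : ℂ :=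
  corr L p F fun k => Complex.exp (Complex.I * s * k)

/-- The entries of the correlation sequence. -/
noncomputable def entry (L : ℝ[X] →ₗ[ℝ] ℝ) (p : ℕ) (F : ℤ → ℝ[X]) (k : ℤ) : ℝ :=
  corr L p F (Pi.single k 1)

variable (L : ℝ[X] →ₗ[ℝ] ℝ) (p : ℕ) (F : ℤ → ℝ[X])

lemma corr_comp_neg (U : ℤ → E) : corr L p F (fun k => U (-k)) = corr L p F U := by
  rw [corr, Finset.sum_comm, corr]
  refine Finset.sum_congr rfl fun m _ => Finset.sum_congr rfl fun l _ => ?_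
  rw [neg_sub, mul_comm]

lemma corr_smul_add_smul (L' : ℝ[X] →ₗ[ℝ] ℝ) (a b : ℝ) (U : ℤ → E) :
    corr (a • L + b • L') p F U = a • corr L p F U + b • corr L' p F U := by
  simp only [corr, Finset.smul_sum, ← Finset.sum_add_distrib]
  refine Finset.sum_congr rfl fun m _ => Finset.sum_congr rfl fun l _ => ?_
  simp [add_smul, mul_smul]

lemma corr_sub (L' : ℝ[X] →ₗ[ℝ] ℝ) (U : ℤ → E) :
    corr (L - L') p F U = corr L p F U - corr L' p F U := by
  simp only [corr, ← Finset.sum_sub_distrib]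
  refine Finset.sum_congr rfl fun m _ => Finset.sum_congr rfl fun l _ => ?_
  simp [sub_smul]

variable {L p F} in
lemma corr_congr {L' : ℝ[X] →ₗ[ℝ] ℝ} {d q : ℕ} (hL : ∀ f : ℝ[X], f.natDegree ≤ d → L f = L' f)
    (hF : ∀ i, (F i).natDegree ≤ q) (hd : 2 * q ≤ d) (U : ℤ → E) :
    corr L p F U = corr L' p F U := by
  refine Finset.sum_congr rfl fun m _ => Finset.sum_congr rfl fun l _ => ?_
  rw [hL]
  have := natDegree_mul_le (p := F m) (q := F l)
  have := hF m
  have := hF l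
  omega

lemma moment_of_odd {r : ℕ} (hr : Odd r) : moment L p F r = 0 := by
  have h := corr_comp_neg L p F (fun k => (k : ℝ) ^ r)
  have h2 : corr L p F (fun k : ℤ => ((-k : ℤ) : ℝ) ^ r) = - corr L p F fun k => (k : ℝ) ^ r := by
    simp only [corr, ← Finset.sum_neg_distrib]
    refine Finset.sum_congr rfl fun m _ => Finset.sum_congr rfl fun l _ => ?_
    push_cast
    rw [hr.neg_pow]; simp
  rw [h2] at h
  rw [moment]; linarith

/-- The entries are even in `k`, so the positive lags carry half of an even moment; `r ≠ 0` removes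
the lag `k = 0`. -/
lemma sum_pow_mul_entry {r : ℕ} (hr : r ≠ 0) :
    2 * ∑ k ∈ Finset.Icc 1 p, (k : ℝ) ^ (2 * r) * entry L p F k = moment L p F (2 * r) := by
  have key : ∑ k ∈ Finset.Icc 1 p, (k : ℝ) ^ (2 * r) * entry L p F k =
      corr L p F fun k => if 0 < k then (k : ℝ) ^ (2 * r) else 0 := by
    simp only [entry, corr, Finset.mul_sum]
    rw [Finset.sum_comm]
    refine Finset.sum_congr rfl fun m hm => ?_
    rw [Finset.sum_comm]
    refine Finset.sum_congr rfl fun l hl => ?_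
    simp only [Pi.single_apply, smul_eq_mul]
    rw [Finset.mem_range] at hm
    split_ifs with h
    · have e : (m : ℤ) - l = (m - l : ℕ) := by omega
      rw [Finset.sum_eq_single (m - l)]
      · rw [e]; simp [mul_comm]
      · intro k _ hk
        rw [if_neg (by omega)]; simp
      · intro hk
        simp only [Finset.mem_Icc] at hk; omega
    · rw [mul_zero]
      refine Finset.sum_eq_zero fun k hk => ?_
      rw [Finset.mem_Icc] at hk
      rw [if_neg (by omega)]; simp
  have key2 := corr_comp_neg L p F fun k => if 0 < k then (k : ℝ) ^ (2 * r) else 0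
  rw [two_mul, key]
  nth_rw 1 [← key2]
  simp only [moment, corr, ← Finset.sum_add_distrib]
  refine Finset.sum_congr rfl fun m hm => Finset.sum_congr rfl fun l hl => ?_
  rw [← smul_add]
  congr 1
  rcases lt_trichotomy ((m : ℤ) - l) 0 with h | h | h
  · rw [if_pos (by omega), if_neg (by omega), add_zero]
    push_cast
    rw [Even.neg_pow (even_two_mul r)]
  · rw [h]; simp [hr]
  · rw [if_neg (by omega), if_pos h, zero_add]

lemma symbol_sub_taylor_isBigO (n : ℕ) :
    (fun s : ℝ => symbol L p F s -
      ∑ r ∈ Finset.range n, (Complex.I * s) ^ r / (r.factorial : ℂ) * (moment L p F r : ℂ))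
      =O[𝓝 0] fun s => s ^ n := by
  have e : (fun s : ℝ => symbol L p F s -
      ∑ r ∈ Finset.range n, (Complex.I * s) ^ r / (r.factorial : ℂ) * (moment L p F r : ℂ)) =
      fun s : ℝ => ∑ m ∈ Finset.range (p + 1), ∑ l ∈ Finset.range (p + 1), (L (F m * F l) : ℂ) *
        (Complex.exp (Complex.I * s * ((m - l : ℤ) : ℂ)) -
          ∑ r ∈ Finset.range n, (Complex.I * s * ((m - l : ℤ) : ℂ)) ^ r / (r.factorial : ℂ)) := by
    funext s
    simp only [mul_sub, Finset.sum_sub_distrib]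
    congr 1
    simp only [moment, corr, Complex.ofReal_sum, Finset.mul_sum]
    rw [Finset.sum_comm]
    refine Finset.sum_congr rfl fun m _ => ?_
    rw [Finset.sum_comm]
    refine Finset.sum_congr rfl fun l _ => Finset.sum_congr rfl fun r _ => ?_
    simp only [smul_eq_mul, Complex.ofReal_mul, Complex.ofReal_pow, Complex.ofReal_intCast]
    rw [mul_pow (Complex.I * s)]
    ring
  rw [e]
  refine Asymptotics.IsBigO.fun_sum fun m _ => Asymptotics.IsBigO.fun_sum fun l _ => ?_
  refine Asymptotics.IsBigO.const_mul_left ?_ _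
  have ht : Tendsto (fun s : ℝ => Complex.I * s * ((m - l : ℤ) : ℂ)) (𝓝 0) (𝓝 0) := by
    have : Continuous fun s : ℝ => Complex.I * s * ((m - l : ℤ) : ℂ) := by fun_prop
    simpa using this.tendsto 0
  refine ((Complex.exp_sub_sum_range_isBigO_pow n).comp_tendsto ht).trans ?_
  refine Asymptotics.IsBigO.of_bound (‖((m - l : ℤ) : ℂ)‖ ^ n) (Eventually.of_forall fun s => ?_)
  simp only [Function.comp_apply, norm_pow, norm_mul, Complex.norm_I, Complex.norm_real, one_pow,
    one_mul, mul_pow]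
  rw [mul_comm]

lemma symbol_re_eq (s : ℝ) : ((symbol L p F s).re : ℂ) = symbol L p F s := by
  refine Complex.conj_eq_iff_re.mp ?_
  have h := corr_comp_neg L p F fun k => Complex.exp (Complex.I * s * k)
  rw [symbol]
  nth_rw 2 [← h]
  simp only [corr, map_sum]
  refine Finset.sum_congr rfl fun m _ => Finset.sum_congr rfl fun l _ => ?_
  rw [Complex.real_smul, Complex.real_smul, map_mul, Complex.conj_ofReal, ← Complex.exp_conj]
  congr 2
  simp
  ring

end Correlation

/-! ### The mass error of a quadrature rule and its generating function -/

/-- A polynomial expression that vanishes to the order of its length is zero. -/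
lemma eq_zero_of_sum_isBigO {c : ℕ → ℂ} (n : ℕ)
    (h : (fun s : ℝ => ∑ r ∈ Finset.range n, c r * (s : ℂ) ^ r) =O[𝓝[≠] 0] fun s => s ^ n) :
    ∀ r < n, c r = 0 := by
  induction n with
  | zero => simp
  | succ n ih =>
    have hpow : (fun s : ℝ => s ^ (n + 1)) =O[𝓝[≠] 0] fun s => s ^ n :=
      (Asymptotics.isLittleO_pow_pow n.lt_succ_self).isBigO.mono nhdsWithin_le_nhds
    have hlast : (fun s : ℝ => c n * (s : ℂ) ^ n) =O[𝓝[≠] 0] fun s => s ^ n :=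
      Asymptotics.IsBigO.of_bound ‖c n‖ (Eventually.of_forall fun s => by simp)
    have h0 : ∀ r < n, c r = 0 := ih <| by
      refine ((h.trans hpow).sub hlast).congr_left fun s => ?_
      rw [Finset.sum_range_succ]; ring
    have hn : c n = 0 := by
      have h1 : (fun s : ℝ => c n * (s : ℂ) ^ n) =O[𝓝[≠] 0] fun s => s ^ (n + 1) := by
        refine h.congr_left fun s => ?_
        rw [Finset.sum_range_succ, Finset.sum_eq_zero, zero_add]
        intro r hr
        rw [h0 r (Finset.mem_range.mp hr), zero_mul]
      obtain ⟨K, hK⟩ := h1.bound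
      have hlim : Tendsto (fun s : ℝ => K * |s|) (𝓝[≠] 0) (𝓝 0) := by
        have : Continuous fun s : ℝ => K * |s| := by fun_prop
        exact (this.tendsto' 0 0 (by simp)).mono_left nhdsWithin_le_nhds
      have : ‖c n‖ ≤ 0 := by
        refine ge_of_tendsto hlim ?_
        filter_upwards [hK, self_mem_nhdsWithin] with s hs hs0
        have hpos : 0 < |s| ^ n := by have := abs_pos.mpr hs0; positivity
        simp only [norm_mul, norm_pow, Complex.norm_real, Real.norm_eq_abs] at hs
        rw [pow_succ] at hs
        refine le_of_mul_le_mul_right ?_ hpos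
        linarith
      exact norm_le_zero_iff.mp this
    intro r hr
    rcases Nat.lt_succ_iff_lt_or_eq.mp hr with h' | h'
    · exact h0 r h'
    · exact h' ▸ hn

/-- The generating function of the `k`-th coefficients of the pieces of a B-spline. -/
noncomputable def coeffGen (p k : ℕ) (z : ℂ) : ℂ :=
  ∑ m ∈ Finset.range (p + 1), ((piece p m).coeff k : ℂ) * z ^ m

/-- On generating functions, `derivative_piece_succ` says that differentiation in the local variable
is multiplication by `1 - z`. -/
lemma coeffGen_succ (p k : ℕ) (z : ℂ) :
    ((k : ℂ) + 1) * coeffGen (p + 1) (k + 1) z = (1 - z) * coeffGen p k z := by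
  have h := sum_sub_shift_mul_pow (fun i => ((piece p i).coeff k : ℂ)) p z
    (by rw [piece_eq_zero (by simp)]; simp) (by rw [piece_eq_zero (by simp)]; simp)
  rw [coeffGen, coeffGen, ← h, Finset.mul_sum]
  refine Finset.sum_congr rfl fun i _ => ?_
  have hd := congrArg (fun f => f.coeff k) (derivative_piece_succ p i)
  simp only [coeff_derivative, coeff_sub] at hd
  rw [← Complex.ofReal_sub, ← hd]
  push_cast; ring

lemma coeffGen_self (p : ℕ) (z : ℂ) : coeffGen p p z = (1 - z) ^ p / (p.factorial : ℂ) := by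
  induction p with
  | zero => simp [coeffGen, piece]
  | succ p ih =>
    have h := coeffGen_succ p p z
    rw [ih] at h
    have h1 : (p : ℂ) + 1 ≠ 0 := by exact_mod_cast p.succ_ne_zero
    have h2 : (p.factorial : ℂ) ≠ 0 := by exact_mod_cast p.factorial_ne_zero
    rw [Nat.factorial_succ]; push_cast
    field_simp at h ⊢
    linear_combination h

lemma coeffGen_succ_self (p : ℕ) (z : ℂ) :
    coeffGen (p + 1) p z = z * (1 - z) ^ p / (p.factorial : ℂ) := by
  induction p with
  | zero => norm_num [coeffGen, piece, Finset.sum_range_succ]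
  | succ p ih =>
    have h := coeffGen_succ (p + 1) p z
    rw [ih] at h
    have h1 : (p : ℂ) + 1 ≠ 0 := by exact_mod_cast p.succ_ne_zero
    have h2 : (p.factorial : ℂ) ≠ 0 := by exact_mod_cast p.factorial_ne_zero
    rw [Nat.factorial_succ]; push_cast
    field_simp at h ⊢
    linear_combination h

lemma coeff_mul_two_mul_add_one {R : Type*} [CommRing R] {f g : R[X]} {q : ℕ}
    (hf : f.natDegree ≤ q + 1) (hg : g.natDegree ≤ q + 1) :
    (f * g).coeff (2 * q + 1) =
      f.coeff q * g.coeff (q + 1) + f.coeff (q + 1) * g.coeff q := by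
  rw [coeff_mul, ← Finset.sum_subset
    (s₁ := ({(q, q + 1), (q + 1, q)} : Finset (ℕ × ℕ))), Finset.sum_pair (by simp)]
  · intro x hx
    simp only [Finset.mem_insert, Finset.mem_singleton] at hx
    rw [Finset.HasAntidiagonal.mem_antidiagonal]
    rcases hx with rfl | rfl <;> simp <;> omega
  · rintro ⟨a, b⟩ hx hx'
    rw [Finset.HasAntidiagonal.mem_antidiagonal] at hx
    simp only [Finset.mem_insert, Finset.mem_singleton, Prod.mk.injEq] at hx hx'
    rcases lt_or_ge (q + 1) a with h | h
    · rw [coeff_eq_zero_of_natDegree_lt (by omega), zero_mul]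
    · rw [coeff_eq_zero_of_natDegree_lt (p := g) (by omega), mul_zero]

/-- A functional that annihilates low degrees sees only the top two coefficients. -/
lemma apply_eq_of_annihilates {E : ℝ[X] →ₗ[ℝ] ℝ} {q : ℕ}
    (hE : ∀ f : ℝ[X], f.natDegree ≤ 2 * q → E f = 0) {f : ℝ[X]}
    (hf : f.natDegree ≤ 2 * q + 2) :
    E f = f.coeff (2 * q + 2) * E (X ^ (2 * q + 2)) +
      f.coeff (2 * q + 1) * E (X ^ (2 * q + 1)) := by
  have h := hE (f - f.coeff (2 * q + 2) • X ^ (2 * q + 2) - f.coeff (2 * q + 1) • X ^ (2 * q + 1)) <| by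
    rw [natDegree_le_iff_coeff_eq_zero]
    intro n hn
    simp only [coeff_sub, coeff_smul, coeff_X_pow, smul_eq_mul, mul_ite, mul_one, mul_zero]
    rcases lt_trichotomy n (2 * q + 2) with h | h | h
    · have : n = 2 * q + 1 := by omega
      subst this; simp
    · subst h; simp
    · rw [coeff_eq_zero_of_natDegree_lt (by omega), if_neg (by omega), if_neg (by omega)]; simp
  rw [map_sub, map_sub, map_smul, map_smul, smul_eq_mul, smul_eq_mul] at h
  linarith

/-- The factor of the mass error of a rule whose error functional is `E`. -/
noncomputable def errorFactor (E : ℝ[X] →ₗ[ℝ] ℝ) (q : ℕ) : ℝ :=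
  E (X ^ (2 * q + 2)) / ((q + 1).factorial : ℝ) ^ 2 -
    E (X ^ (2 * q + 1)) / ((q + 1).factorial * q.factorial : ℝ)

/-- The generating function of the mass errors. -/
lemma sum_annihilates_piece {E : ℝ[X] →ₗ[ℝ] ℝ} {q : ℕ}
    (hE : ∀ f : ℝ[X], f.natDegree ≤ 2 * q → E f = 0) {z w : ℂ} (hzw : z * w = 1) :
    ∑ m ∈ Finset.range (q + 2), ∑ l ∈ Finset.range (q + 2),
      (E (piece (q + 1) m * piece (q + 1) l) : ℂ) * (z ^ m * w ^ l) =
      errorFactor E q * ((1 - z) * (1 - w)) ^ (q + 1) := by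
  have e : ∀ m l : ℕ, (E (piece (q + 1) m * piece (q + 1) l) : ℂ) * (z ^ m * w ^ l) =
      (E (X ^ (2 * q + 2)) : ℂ) * ((((piece (q + 1) m).coeff (q + 1) : ℂ) * z ^ m) *
        (((piece (q + 1) l).coeff (q + 1) : ℂ) * w ^ l)) +
      (E (X ^ (2 * q + 1)) : ℂ) * ((((piece (q + 1) m).coeff q : ℂ) * z ^ m) *
        (((piece (q + 1) l).coeff (q + 1) : ℂ) * w ^ l)) +
      (E (X ^ (2 * q + 1)) : ℂ) * ((((piece (q + 1) m).coeff (q + 1) : ℂ) * z ^ m) *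
        (((piece (q + 1) l).coeff q : ℂ) * w ^ l)) := fun m l => by
    have hm := natDegree_piece_le (q + 1) m
    have hl := natDegree_piece_le (q + 1) l
    rw [apply_eq_of_annihilates hE (natDegree_mul_le.trans (by omega)),
      coeff_mul_two_mul_add_one hm hl, show 2 * q + 2 = (q + 1) + (q + 1) by ring,
      coeff_mul_add_eq_of_natDegree_le hm hl]
    push_cast; ring
  simp only [e, Finset.sum_add_distrib, ← Finset.mul_sum, ← Finset.sum_mul]
  have h1 := coeffGen_self (q + 1)
  have h2 := coeffGen_succ_self q
  simp only [coeffGen] at h1 h2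
  simp only [Nat.reduceAdd, add_assoc] at h1 h2 ⊢
  rw [h1, h1, h2, h2, errorFactor]
  push_cast
  rw [mul_pow]
  -- This is where `z * w = 1` enters: the two mixed products of a top and a next-to-top coefficient
  -- merge into the same power as the product of the top coefficients.
  have k : (z * (1 - w) + (1 - z) * w) = - ((1 - z) * (1 - w)) := by linear_combination - hzw
  have k2 : z * (1 - z) ^ q * (1 - w) ^ (q + 1) + (1 - z) ^ (q + 1) * (w * (1 - w) ^ q) =
      - ((1 - z) ^ (q + 1) * (1 - w) ^ (q + 1)) := by
    linear_combination (1 - z) ^ q * (1 - w) ^ q * k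
  linear_combination (E (X ^ (2 * q + 1)) : ℂ) / (((q + 1).factorial : ℂ) * q.factorial) * k2

/-- The entries of the mass error vanish if its factor does. -/
lemma entry_eq_zero_of_errorFactor {E : ℝ[X] →ₗ[ℝ] ℝ} {q : ℕ}
    (hE : ∀ f : ℝ[X], f.natDegree ≤ 2 * q → E f = 0) (h0 : errorFactor E q = 0) (k : ℤ) :
    entry E (q + 1) (piece (q + 1)) k = 0 := by
  -- The generating function at `w = z⁻¹`, multiplied by `z ^ (q + 1)` to clear negative powers. It
  -- vanishes at every `z ≠ 0`, hence identically, and its coefficients are the entries.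
  set f : ℂ[X] := ∑ m ∈ Finset.range (q + 2), ∑ l ∈ Finset.range (q + 2),
    C (E (piece (q + 1) m * piece (q + 1) l) : ℂ) * X ^ (m + (q + 1 - l)) with hf
  have hroot : f = 0 := by
    refine eq_zero_of_infinite_isRoot f (Set.Infinite.mono (s := {z : ℂ | z ≠ 0}) ?_ ?_)
    · intro z hz
      have hz : z ≠ 0 := hz
      have h := sum_annihilates_piece hE (mul_inv_cancel₀ hz)
      rw [h0, Complex.ofReal_zero, zero_mul] at h
      have : f.eval z = z ^ (q + 1) * 0 := by
        rw [← h, hf]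
        simp only [eval_finsetSum, Finset.mul_sum, eval_mul, eval_C, eval_pow, eval_X]
        refine Finset.sum_congr rfl fun m _ => Finset.sum_congr rfl fun l hl => ?_
        have hl : l ≤ q + 1 := by rw [Finset.mem_range] at hl; omega
        rw [pow_add, ← pow_sub_mul_pow z hl, inv_pow]
        have : z ^ l ≠ 0 := pow_ne_zero _ hz
        field_simp
      simpa using this
    · exact (Set.finite_singleton (0 : ℂ)).infinite_compl
  have hc : ∀ n : ℕ, k + (q + 1) = n → entry E (q + 1) (piece (q + 1)) k = 0 := fun n hn => by
    have h := congrArg (fun f => f.coeff n) hroot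
    simp only [hf, finsetSum_coeff, coeff_C_mul, coeff_X_pow, coeff_zero, mul_ite, mul_one,
      mul_zero] at h
    have e : (entry E (q + 1) (piece (q + 1)) k : ℂ) = 0 := by
      rw [← h]
      simp only [entry, corr, Complex.ofReal_sum]
      refine Finset.sum_congr rfl fun m _ => Finset.sum_congr rfl fun l hl => ?_
      rw [Finset.mem_range] at hl
      rw [Pi.single_apply]
      by_cases hk : (m : ℤ) - l = k
      · rw [if_pos hk, if_pos (by omega)]; simp
      · rw [if_neg hk, if_neg (by omega)]; simp
    exact_mod_cast e
  by_cases hk : 0 ≤ k + (q + 1)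
  · exact hc (k + (q + 1)).toNat (by omega)
  · rw [entry, corr]
    refine Finset.sum_eq_zero fun m _ => Finset.sum_eq_zero fun l hl => ?_
    rw [Finset.mem_range] at hl
    rw [Pi.single_apply, if_neg (by omega), smul_zero]

lemma symbol_annihilates_piece {E : ℝ[X] →ₗ[ℝ] ℝ} {q : ℕ}
    (hE : ∀ f : ℝ[X], f.natDegree ≤ 2 * q → E f = 0) (s : ℝ) :
    symbol E (q + 1) (piece (q + 1)) s = errorFactor E q *
      ((1 - Complex.exp (Complex.I * s)) * (1 - Complex.exp (-(Complex.I * s)))) ^ (q + 1) := by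
  rw [← sum_annihilates_piece hE (by rw [← Complex.exp_add]; simp), symbol, corr]
  refine Finset.sum_congr rfl fun m _ => Finset.sum_congr rfl fun l _ => ?_
  rw [Complex.real_smul, ← Complex.exp_nat_mul, ← Complex.exp_nat_mul, ← Complex.exp_add]
  congr 2
  push_cast; ring

lemma one_sub_exp_isTheta :
    (fun s : ℝ => (1 - Complex.exp (Complex.I * s)) * (1 - Complex.exp (-(Complex.I * s))))
      =Θ[𝓝[≠] 0] fun s : ℝ => s ^ 2 := by
  have key : ∀ c : ℂ, c ≠ 0 →
      (fun s : ℝ => 1 - Complex.exp (c * s)) =Θ[𝓝[≠] 0] fun s : ℝ => s := fun c hc => by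
    have hd : HasDerivAt (fun s : ℝ => 1 - Complex.exp (c * s)) (-c) 0 := by
      have h1 : HasDerivAt (fun s : ℝ => c * (s : ℂ)) c 0 := by
        simpa using (Complex.ofRealCLM.hasDerivAt (x := 0)).const_mul c
      simpa using (h1.cexp).const_sub 1
    have h := hd.isTheta_sub (neg_ne_zero.mpr hc)
    have ht : Tendsto (fun s : ℝ => (s, (0 : ℝ))) (𝓝[≠] 0) (𝓝 0 ×ˢ pure 0) :=
      (tendsto_id.mono_left nhdsWithin_le_nhds).prodMk tendsto_const_pure
    have h' := And.intro (h.1.comp_tendsto ht) (h.2.comp_tendsto ht)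
    simpa [Asymptotics.IsTheta, Function.comp_def] using h'
  have h := (key Complex.I Complex.I_ne_zero).mul (key (-Complex.I) (by simp))
  simpa [pow_two] using h

/-- The closed form of the symbol is `O(s ^ (2 * q + 2))`, and the moments are its Taylor
coefficients up to nonzero factors. -/
lemma moment_annihilates_piece {E : ℝ[X] →ₗ[ℝ] ℝ} {q : ℕ}
    (hE : ∀ f : ℝ[X], f.natDegree ≤ 2 * q → E f = 0) {r : ℕ} (hr : r < 2 * q + 2) :
    moment E (q + 1) (piece (q + 1)) r = 0 := by
  have h1 : (fun s : ℝ => symbol E (q + 1) (piece (q + 1)) s) =O[𝓝[≠] 0]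
      fun s => s ^ (2 * q + 2) := by
    simp only [symbol_annihilates_piece hE]
    refine ((one_sub_exp_isTheta.1.pow (q + 1)).const_mul_left _).congr_right fun s => ?_
    ring
  have h2 := (symbol_sub_taylor_isBigO E (q + 1) (piece (q + 1)) (2 * q + 2)).mono
    (nhdsWithin_le_nhds (s := {0}ᶜ))
  have h3 := eq_zero_of_sum_isBigO
    (c := fun r => Complex.I ^ r / (r.factorial : ℂ) * moment E (q + 1) (piece (q + 1)) r)
    (2 * q + 2) ((h1.sub h2).congr_left fun s => by
      rw [sub_sub_cancel]
      refine Finset.sum_congr rfl fun r _ => ?_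
      rw [mul_pow]; ring) r hr
  have : (r.factorial : ℂ) ≠ 0 := by exact_mod_cast r.factorial_ne_zero
  simpa [this] using h3

/-- If this moment vanished too, the symbol would be `O(s ^ (2 * q + 3))`, while a nonzero
`errorFactor` makes its order exactly `2 * q + 2`. -/
lemma moment_annihilates_piece_ne_zero {E : ℝ[X] →ₗ[ℝ] ℝ} {q : ℕ}
    (hE : ∀ f : ℝ[X], f.natDegree ≤ 2 * q → E f = 0) (h0 : errorFactor E q ≠ 0) :
    moment E (q + 1) (piece (q + 1)) (2 * q + 2) ≠ 0 := by
  intro hm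
  have h2 := (symbol_sub_taylor_isBigO E (q + 1) (piece (q + 1)) (2 * q + 3)).mono
    (nhdsWithin_le_nhds (s := {0}ᶜ))
  have h3 : (fun s : ℝ => symbol E (q + 1) (piece (q + 1)) s) =O[𝓝[≠] 0]
      fun s => s ^ (2 * q + 3) := by
    refine h2.congr_left fun s => ?_
    rw [Finset.sum_eq_zero, sub_zero]
    intro r hr
    rw [Finset.mem_range] at hr
    rcases Nat.lt_succ_iff_lt_or_eq.mp hr with h | h
    · rw [moment_annihilates_piece hE h]; simp
    · rw [h, hm]; simp
  have h1 : (fun s : ℝ => s ^ (2 * q + 2)) =O[𝓝[≠] 0] fun s : ℝ => s ^ (2 * q + 3) := by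
    refine Asymptotics.IsBigO.trans ?_ h3
    simp only [symbol_annihilates_piece hE]
    refine Asymptotics.IsBigO.trans ?_ (Asymptotics.isBigO_self_const_mul ?_ _ _)
    · refine (one_sub_exp_isTheta.2.pow (q + 1)).congr_left fun s => ?_
      ring
    · exact_mod_cast h0
  have h4 := h1.trans_isLittleO
    ((Asymptotics.isLittleO_pow_pow (Nat.lt_succ_self _)).mono nhdsWithin_le_nhds)
  refine Asymptotics.isLittleO_irrefl ?_ h4
  refine Eventually.frequently ?_
  filter_upwards [self_mem_nhdsWithin] with s hs
  exact pow_ne_zero _ hs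

/-! ### Exponential splines and the symbol of the exact Galerkin method -/

/-- Integration of polynomials over the reference element. -/
noncomputable def intFunctional : ℝ[X] →ₗ[ℝ] ℝ where
  toFun f := ∫ t in (0 : ℝ)..1, f.eval t
  map_add' f g := by
    simp only [eval_add]
    exact intervalIntegral.integral_add (f.continuous.intervalIntegrable _ _)
      (g.continuous.intervalIntegrable _ _)
  map_smul' c f := by simp

lemma intFunctional_apply (f : ℝ[X]) : intFunctional f = ∫ t in (0 : ℝ)..1, f.eval t := rfl

/-- The exponential generating function of a family of polynomials. -/
noncomputable def expGen (p : ℕ) (F : ℤ → ℝ[X]) (s x : ℝ) : ℂ :=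
  ∑ m ∈ Finset.range (p + 1), (((F m).eval x : ℝ) : ℂ) * Complex.exp (-(Complex.I * s)) ^ m

lemma continuous_expGen (p : ℕ) (F : ℤ → ℝ[X]) (s : ℝ) : Continuous (expGen p F s) := by
  unfold expGen
  have : ∀ m : ℤ, Continuous fun x : ℝ => (((F m).eval x : ℝ) : ℂ) := fun m =>
    Complex.continuous_ofReal.comp (F m).continuous
  fun_prop

lemma symbol_intFunctional (p : ℕ) (F : ℤ → ℝ[X]) (s : ℝ) :
    symbol intFunctional p F s = ∫ x in (0 : ℝ)..1, expGen p F s x * expGen p F (-s) x := by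
  have hc : ∀ m : ℤ, Continuous fun x : ℝ => (((F m).eval x : ℝ) : ℂ) := fun m =>
    Complex.continuous_ofReal.comp (F m).continuous
  have e : ∀ x : ℝ, expGen p F s x * expGen p F (-s) x =
      ∑ m ∈ Finset.range (p + 1), ∑ l ∈ Finset.range (p + 1),
        (((F m * F l).eval x : ℝ) : ℂ) * Complex.exp (Complex.I * s * ((m - l : ℤ) : ℂ)) := by
    intro x
    rw [mul_comm, expGen, expGen, Finset.sum_mul_sum]
    refine Finset.sum_congr rfl fun m _ => Finset.sum_congr rfl fun l _ => ?_
    rw [← Complex.exp_nat_mul, ← Complex.exp_nat_mul, mul_mul_mul_comm, ← Complex.exp_add, eval_mul,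
      Complex.ofReal_mul]
    congr 2
    push_cast
    ring
  simp only [e, symbol, corr]
  rw [intervalIntegral.integral_finsetSum]
  · refine Finset.sum_congr rfl fun m _ => ?_
    rw [intervalIntegral.integral_finsetSum]
    · refine Finset.sum_congr rfl fun l _ => ?_
      rw [intervalIntegral.integral_mul_const, intervalIntegral.integral_ofReal,
        intFunctional_apply, Complex.real_smul]
    · intro l _
      simp only [eval_mul, Complex.ofReal_mul]
      exact Continuous.intervalIntegrable (by have := hc m; have := hc l; fun_prop) _ _
  · intro m _
    refine Continuous.intervalIntegrable (continuous_finsetSum _ fun l _ => ?_) _ _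
    simp only [eval_mul, Complex.ofReal_mul]
    have := hc m; have := hc l; fun_prop

/-- The Poincaré inequality for quasi-periodic functions of small frequency. -/
lemma norm_le_of_orthogonal_exp {R R' : ℝ → ℂ} {s K : ℝ} (hs : |s| ≤ 1 / 2)
    (hR : ∀ x, HasDerivAt R (R' x) x) (hK : ∀ x ∈ Set.Icc (0 : ℝ) 1, ‖R' x‖ ≤ K)
    (h0 : ∫ x in (0 : ℝ)..1, R x * Complex.exp (-(Complex.I * s * x)) = 0) :
    ∀ x ∈ Set.Icc (0 : ℝ) 1, ‖R x‖ ≤ 2 * K := by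
  intro x hx
  have hRc : Continuous R := continuous_iff_continuousAt.mpr fun x => (hR x).continuousAt
  have hE : Continuous fun y : ℝ => Complex.exp (-(Complex.I * s * y)) := by fun_prop
  have hnorm : ∀ y : ℝ, ‖Complex.exp (-(Complex.I * s * y))‖ = 1 := fun y => by
    rw [Complex.norm_exp]; simp
  have hK0 : 0 ≤ K := (norm_nonneg _).trans (hK x hx)
  set c := ∫ y in (0 : ℝ)..1, Complex.exp (-(Complex.I * s * y)) with hc
  have hc1 : ‖c - 1‖ ≤ 1 / 2 := by
    have e : c - 1 = ∫ y in (0 : ℝ)..1, (Complex.exp (-(Complex.I * s * y)) - 1) := by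
      rw [intervalIntegral.integral_sub (hE.intervalIntegrable _ _)
        (by simp)]
      simp [hc]
    rw [e]
    have := intervalIntegral.norm_integral_le_of_norm_le_const (a := (0 : ℝ)) (b := 1)
      (f := fun y : ℝ => Complex.exp (-(Complex.I * s * y)) - 1) (C := 1 / 2) (fun y hy => by
        rw [Set.uIoc_of_le zero_le_one] at hy
        have h := Real.norm_exp_I_mul_ofReal_sub_one_le (x := -(s * y))
        have e2 : Complex.I * ((-(s * y) : ℝ) : ℂ) = -(Complex.I * s * y) := by push_cast; ring
        rw [e2, norm_neg, Real.norm_eq_abs, abs_mul, abs_of_pos hy.1] at h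
        refine h.trans ?_
        have := abs_nonneg s
        nlinarith [hy.2, hy.1])
    simpa using this
  have hc2 : 1 / 2 ≤ ‖c‖ := by
    have := norm_sub_norm_le (1 : ℂ) (1 - c)
    rw [norm_sub_rev 1 c, sub_sub_cancel, norm_one] at this
    linarith
  -- Orthogonality lets `R y` be subtracted for free, so `R x` is controlled by increments of `R`;
  -- the constant 2 of the bound comes from `‖c‖ ≥ 1 / 2`.
  have key : R x * c = ∫ y in (0 : ℝ)..1, (R x - R y) * Complex.exp (-(Complex.I * s * y)) := by
    simp only [sub_mul]
    rw [intervalIntegral.integral_sub (Continuous.intervalIntegrable (by fun_prop) _ _)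
      (Continuous.intervalIntegrable (by fun_prop) _ _), h0, sub_zero, intervalIntegral.integral_const_mul]
  have h2 : ‖R x * c‖ ≤ K := by
    rw [key]
    have := intervalIntegral.norm_integral_le_of_norm_le_const (a := (0 : ℝ)) (b := 1)
      (f := fun y : ℝ => (R x - R y) * Complex.exp (-(Complex.I * s * y))) (C := K) (fun y hy => by
        rw [Set.uIoc_of_le zero_le_one] at hy
        have hy' : y ∈ Set.Icc (0 : ℝ) 1 := ⟨hy.1.le, hy.2⟩
        rw [norm_mul, hnorm, mul_one]
        have h := (convex_Icc (0 : ℝ) 1).norm_image_sub_le_of_norm_hasDerivWithin_le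
          (fun z hz => (hR z).hasDerivWithinAt) hK hy' hx
        refine h.trans (mul_le_of_le_one_right hK0 ?_)
        rw [Real.norm_eq_abs, abs_le]
        constructor <;> linarith [hx.1, hx.2, hy.1, hy.2])
    simpa using this
  rw [norm_mul] at h2
  nlinarith [norm_nonneg (R x)]

/-- Subtracting a solution of `u'' = - s ^ 2 u` from a quasi-periodic function does not change
the energy. -/
lemma integral_energy_sub_exp {Ψ Ψ' Φ Φ' : ℝ → ℂ} {s : ℝ} (c d : ℂ)
    (hΨ : ∀ x, HasDerivAt Ψ (Ψ' x) x) (hΦ : ∀ x, HasDerivAt Φ (Φ' x) x)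
    (hΨc : Continuous Ψ') (hΦc : Continuous Φ')
    (hΨ1 : Ψ 1 = Complex.exp (Complex.I * s) * Ψ 0)
    (hΦ1 : Φ 1 = Complex.exp (-(Complex.I * s)) * Φ 0) :
    ∫ x in (0 : ℝ)..1, (Ψ' x * Φ' x - s ^ 2 * (Ψ x * Φ x)) =
      ∫ x in (0 : ℝ)..1, ((Ψ' x - c * (Complex.I * s) * Complex.exp (Complex.I * s * x)) *
          (Φ' x + d * (Complex.I * s) * Complex.exp (-(Complex.I * s * x))) -
        s ^ 2 * ((Ψ x - c * Complex.exp (Complex.I * s * x)) *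
          (Φ x - d * Complex.exp (-(Complex.I * s * x))))) := by
  have hΨc' : Continuous Ψ := continuous_iff_continuousAt.mpr fun x => (hΨ x).continuousAt
  have hΦc' : Continuous Φ := continuous_iff_continuousAt.mpr fun x => (hΦ x).continuousAt
  have hlin : ∀ x : ℝ, HasDerivAt (fun x : ℝ => Complex.I * s * (x : ℂ)) (Complex.I * s) x :=
    fun x => by simpa using (Complex.ofRealCLM.hasDerivAt (x := x)).const_mul (Complex.I * s)
  have hE := fun x => (hlin x).cexp
  have hEb := fun x => (hlin x).neg.cexp
  have hR := fun x => (hΨ x).sub ((hE x).const_mul c)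
  have hS := fun x => (hΦ x).sub ((hEb x).const_mul d)
  -- A primitive of the difference of the two integrands. Its values at 0 and 1 agree, since each of
  -- its terms multiplies factors with opposite quasi-periods.
  have hH := fun x => (((hE x).const_mul (c * (Complex.I * s))).mul (hS x)).sub
    (((hEb x).const_mul (d * (Complex.I * s))).mul (hR x))
  have hsq : (Complex.I * s) * (Complex.I * s) = -(s : ℂ) ^ 2 := by
    linear_combination (s : ℂ) ^ 2 * Complex.I_mul_I
  have hee : ∀ x : ℂ, Complex.exp x * Complex.exp (-x) = 1 := fun x => by
    rw [← Complex.exp_add]; simp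
  rw [← sub_eq_zero, ← intervalIntegral.integral_sub
    (Continuous.intervalIntegrable (by fun_prop) _ _)
    (Continuous.intervalIntegrable (by fun_prop) _ _)]
  rw [intervalIntegral.integral_congr (g := fun x => _)
    (fun x _ => ?_), intervalIntegral.integral_eq_sub_of_hasDerivAt (fun x _ => hH x)]
  · simp only [Pi.mul_apply, Pi.sub_apply, Pi.neg_apply, hΨ1, hΦ1, Complex.ofReal_one, mul_one,
      Complex.ofReal_zero, mul_zero, neg_zero, Complex.exp_zero]
    have := hee (Complex.I * s)
    linear_combination (c * (Complex.I * s) * Φ 0 - d * (Complex.I * s) * Ψ 0) * this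
  · refine Continuous.intervalIntegrable ?_ _ _
    simp only [Pi.sub_apply, Pi.neg_apply]
    fun_prop
  · simp only [Pi.sub_apply, Pi.neg_apply]
    linear_combination (c * d * Complex.exp (Complex.I * s * x) * Complex.exp (-(Complex.I * s * x))
      - d * Complex.exp (-(Complex.I * s * x)) * Ψ x - c * Complex.exp (Complex.I * s * x) * Φ x) * hsq

/-- The family of the derivatives of the pieces of the B-spline of degree `p`. -/
noncomputable def dpiece (p : ℕ) (i : ℤ) : ℝ[X] := derivative (piece p i)

lemma expGen_dpiece_succ (p : ℕ) (s x : ℝ) :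
    expGen (p + 1) (dpiece (p + 1)) s x =
      (1 - Complex.exp (-(Complex.I * s))) * expGen p (piece p) s x := by
  have h := sum_sub_shift_mul_pow (fun i => (((piece p i).eval x : ℝ) : ℂ)) p
    (Complex.exp (-(Complex.I * s)))
    (by rw [piece_eq_zero (by simp)]; simp) (by rw [piece_eq_zero (by simp)]; simp)
  rw [expGen, expGen, ← h]
  refine Finset.sum_congr rfl fun i _ => ?_
  rw [dpiece, derivative_piece_succ, eval_sub, Complex.ofReal_sub]

lemma hasDerivAt_expGen_piece (p : ℕ) (s x : ℝ) :
    HasDerivAt (expGen p (piece p) s) (expGen p (dpiece p) s x) x := by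
  refine HasDerivAt.fun_sum fun m _ => ?_
  exact (((piece p m).hasDerivAt x).ofReal_comp).mul_const _

lemma expGen_piece_succ_one (p : ℕ) (s : ℝ) : expGen (p + 1) (piece (p + 1)) s 1 =
    Complex.exp (Complex.I * s) * expGen (p + 1) (piece (p + 1)) s 0 := by
  have hz : Complex.exp (Complex.I * s) * Complex.exp (-(Complex.I * s)) = 1 := by
    rw [← Complex.exp_add]; simp
  have h0 : (piece (p + 1) 0).eval 0 = 0 := by
    have := eval_one_piece p (-1)
    rw [neg_add_cancel, piece_eq_zero (by simp)] at this
    simpa using this.symm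
  have h1 : (piece (p + 1) (p + 1 : ℕ)).eval 1 = 0 := by
    rw [eval_one_piece, piece_eq_zero (by simp)]; simp
  rw [expGen, expGen, Finset.sum_range_succ, h1, Finset.sum_range_succ' _ (p + 1), Nat.cast_zero, h0]
  simp only [Complex.ofReal_zero, zero_mul, add_zero, Finset.mul_sum]
  refine Finset.sum_congr rfl fun i _ => ?_
  rw [eval_one_piece, pow_succ]
  push_cast
  linear_combination -((((piece (p + 1) (i + 1)).eval 0 : ℝ) : ℂ) *
    Complex.exp (-(Complex.I * s)) ^ i) * hz

/-- The factor of the component of the exponential spline along the exponential. -/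
noncomputable def expCoeff (p : ℕ) (s : ℝ) : ℂ :=
  ((1 - Complex.exp (-(Complex.I * s))) / (Complex.I * s)) ^ (p + 1)

/-- The component of the exponential spline that is orthogonal to the exponential. -/
noncomputable def residual (p : ℕ) (s x : ℝ) : ℂ :=
  expGen p (piece p) s x - expCoeff p s * Complex.exp (Complex.I * s * x)

lemma hasDerivAt_exp_I_mul (s x : ℝ) : HasDerivAt (fun x : ℝ => Complex.exp (Complex.I * s * x))
    (Complex.exp (Complex.I * s * x) * (Complex.I * s)) x := by
  have : HasDerivAt (fun x : ℝ => Complex.I * s * (x : ℂ)) (Complex.I * s) x := by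
    simpa using (Complex.ofRealCLM.hasDerivAt (x := x)).const_mul (Complex.I * s)
  exact this.cexp

/-- Differentiation lowers the degree of the exponential spline at the price of the factor `1 - exp
(-i s)`. The power in `expCoeff` makes the exponential term obey the same rule, so residuals
differentiate to residuals. -/
lemma dpiece_sub_exp {p : ℕ} {s : ℝ} (hs : s ≠ 0) (x : ℝ) :
    expGen (p + 1) (dpiece (p + 1)) s x -
      expCoeff (p + 1) s * (Complex.I * s) * Complex.exp (Complex.I * s * x) =
      (1 - Complex.exp (-(Complex.I * s))) * residual p s x := by
  have hs' : (s : ℂ) ≠ 0 := by exact_mod_cast hs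
  rw [expGen_dpiece_succ, residual, expCoeff, expCoeff, pow_succ _ (p + 1)]
  have := Complex.I_ne_zero
  field_simp

lemma hasDerivAt_residual_succ {p : ℕ} {s : ℝ} (hs : s ≠ 0) (x : ℝ) :
    HasDerivAt (residual (p + 1) s)
      ((1 - Complex.exp (-(Complex.I * s))) * residual p s x) x := by
  have h := (hasDerivAt_expGen_piece (p + 1) s x).sub
    ((hasDerivAt_exp_I_mul s x).const_mul (expCoeff (p + 1) s))
  refine HasDerivAt.congr_deriv (f := residual (p + 1) s) h ?_
  rw [← dpiece_sub_exp hs]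
  ring

lemma hasDerivAt_residual_zero {s : ℝ} (hs : s ≠ 0) (x : ℝ) :
    HasDerivAt (residual 0 s)
      (-((1 - Complex.exp (-(Complex.I * s))) * Complex.exp (Complex.I * s * x))) x := by
  have h := (hasDerivAt_expGen_piece 0 s x).sub
    ((hasDerivAt_exp_I_mul s x).const_mul (expCoeff 0 s))
  refine HasDerivAt.congr_deriv (f := residual 0 s) h ?_
  have hs' : (s : ℂ) ≠ 0 := by exact_mod_cast hs
  have := Complex.I_ne_zero
  simp only [expGen, dpiece, piece, expCoeff]
  simp
  field_simp

lemma norm_one_sub_exp_le (s : ℝ) : ‖1 - Complex.exp (-(Complex.I * s))‖ ≤ |s| := by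
  have h := Real.norm_exp_I_mul_ofReal_sub_one_le (x := -s)
  rw [norm_sub_rev]
  simpa using h

lemma continuous_residual (p : ℕ) (s : ℝ) : Continuous (residual p s) := by
  have := continuous_expGen p (piece p) s
  unfold residual
  fun_prop

lemma exp_mul_exp_neg (z : ℂ) : Complex.exp z * Complex.exp (-z) = 1 := by
  rw [← Complex.exp_add]; simp

/-- Induction on the degree: the derivative of a residual is the previous one times a factor of size
at most `|s|`, and the Poincaré inequality recovers the residual with a factor 2. The orthogonality
it needs is carried along: for positive degree, the product with `exp (-i s x)` has equal values at
0 and 1, so its derivative integrates to zero. -/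
lemma residual_bound {s : ℝ} (hs : s ≠ 0) (hs2 : |s| ≤ 1 / 2) (p : ℕ) :
    (∀ x ∈ Set.Icc (0 : ℝ) 1, ‖residual p s x‖ ≤ (2 * |s|) ^ (p + 1)) ∧
      ∫ x in (0 : ℝ)..1, residual p s x * Complex.exp (-(Complex.I * s * x)) = 0 := by
  have hs' : (s : ℂ) ≠ 0 := by exact_mod_cast hs
  have hi := Complex.I_ne_zero
  have hE : Continuous fun y : ℝ => Complex.exp (-(Complex.I * s * y)) := by fun_prop
  have hder : ∀ x : ℝ, HasDerivAt (fun x : ℝ => Complex.exp (-(Complex.I * s * x)))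
      (Complex.exp (-(Complex.I * s * x)) * (-(Complex.I * s))) x := fun x => by
    have := hasDerivAt_exp_I_mul (-s) x
    simpa using this
  induction p with
  | zero =>
    have h0 : ∫ x in (0 : ℝ)..1, residual 0 s x * Complex.exp (-(Complex.I * s * x)) = 0 := by
      have e : ∀ x : ℝ, residual 0 s x * Complex.exp (-(Complex.I * s * x)) =
          Complex.exp (-(Complex.I * s * x)) * (-(Complex.I * s)) * (-(Complex.I * s))⁻¹ -
            expCoeff 0 s := fun x => by
        have hn : -(Complex.I * s) ≠ 0 := by simp [hs]
        rw [mul_inv_cancel_right₀ hn]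
        simp only [residual, expGen, piece]
        simp
        linear_combination - expCoeff 0 s * exp_mul_exp_neg (Complex.I * s * x)
      simp only [e]
      rw [intervalIntegral.integral_sub (Continuous.intervalIntegrable (by fun_prop) _ _) (by simp),
        intervalIntegral.integral_mul_const,
        intervalIntegral.integral_eq_sub_of_hasDerivAt (fun x _ => hder x)
          (Continuous.intervalIntegrable (by fun_prop) _ _)]
      simp [expCoeff]
      field_simp
      linear_combination (Complex.exp (-(Complex.I * s)) - 1) * Complex.I_sq
    refine ⟨fun x hx => ?_, h0⟩
    have h := norm_le_of_orthogonal_exp (K := |s|) hs2 (hasDerivAt_residual_zero hs)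
      (fun x _ => by
        rw [norm_neg, norm_mul, Complex.norm_exp]
        simpa using norm_one_sub_exp_le s) h0 x hx
    simpa using h
  | succ p ih =>
    have hR := fun x => hasDerivAt_residual_succ (p := p) hs x
    have h0 : ∫ x in (0 : ℝ)..1, residual (p + 1) s x * Complex.exp (-(Complex.I * s * x)) = 0 := by
      have hmul := fun x => (hR x).mul (hder x)
      have hint := intervalIntegral.integral_eq_sub_of_hasDerivAt
        (a := 0) (b := 1) (fun x _ => hmul x) (Continuous.intervalIntegrable (by
          have := continuous_residual p s
          have := continuous_residual (p + 1) s
          fun_prop) _ _)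
      have h1 : residual (p + 1) s 1 = Complex.exp (Complex.I * s) * residual (p + 1) s 0 := by
        simp only [residual, expGen_piece_succ_one]
        simp
        ring
      simp only [Pi.mul_apply, h1] at hint
      have e : ∀ x : ℝ, (1 - Complex.exp (-(Complex.I * s))) * residual p s x *
            Complex.exp (-(Complex.I * s * x)) +
          residual (p + 1) s x * (Complex.exp (-(Complex.I * s * x)) * (-(Complex.I * s))) =
          (1 - Complex.exp (-(Complex.I * s))) *
              (residual p s x * Complex.exp (-(Complex.I * s * x))) +
            (-(Complex.I * s)) * (residual (p + 1) s x * Complex.exp (-(Complex.I * s * x))) :=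
        fun x => by ring
      simp only [e] at hint
      rw [intervalIntegral.integral_add, intervalIntegral.integral_const_mul,
        intervalIntegral.integral_const_mul, ih.2] at hint
      · have hrhs : Complex.exp (Complex.I * s) * residual (p + 1) s 0 *
            Complex.exp (-(Complex.I * s * ((1 : ℝ) : ℂ))) - residual (p + 1) s 0 *
            Complex.exp (-(Complex.I * s * ((0 : ℝ) : ℂ))) = 0 := by
          simp
          linear_combination residual (p + 1) s 0 * exp_mul_exp_neg (Complex.I * s)
        rw [hrhs, mul_zero, zero_add] at hint
        simpa [hs] using hint
      all_goals
        have := continuous_residual p s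
        have := continuous_residual (p + 1) s
        exact Continuous.intervalIntegrable (by fun_prop) _ _
    refine ⟨fun x hx => ?_, h0⟩
    have h := norm_le_of_orthogonal_exp (K := |s| * (2 * |s|) ^ (p + 1)) hs2 hR
      (fun x hx => by
        rw [norm_mul]
        exact mul_le_mul (norm_one_sub_exp_le s) (ih.1 x hx) (norm_nonneg _) (abs_nonneg _)) h0 x hx
    rw [pow_succ _ (p + 1)]
    linarith

/-- The symbol of the exact Galerkin discretization approximates the differential operator. -/
lemma symbol_intFunctional_isBigO (q : ℕ) :
    (fun s : ℝ => symbol intFunctional (q + 1) (dpiece (q + 1)) s -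
      (s : ℂ) ^ 2 * symbol intFunctional (q + 1) (piece (q + 1)) s)
      =O[𝓝[≠] 0] fun s => s ^ (2 * q + 4) := by
  refine Asymptotics.IsBigO.of_bound (2 * 4 ^ (q + 1)) ?_
  have hball : ∀ᶠ s : ℝ in 𝓝[≠] 0, |s| ≤ 1 / 2 := by
    filter_upwards [nhdsWithin_le_nhds (Metric.closedBall_mem_nhds (0 : ℝ) one_half_pos)] with s hs
    simpa using hs
  filter_upwards [hball, self_mem_nhdsWithin] with s hs hs0
  have hs0 : s ≠ 0 := hs0
  have hns : -s ≠ 0 := neg_ne_zero.mpr hs0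
  have hs' : |-s| ≤ 1 / 2 := by rwa [abs_neg]
  have hc := fun t => continuous_expGen (q + 1) (piece (q + 1)) t
  have hd := fun t => continuous_expGen (q + 1) (dpiece (q + 1)) t
  -- The splines of frequencies `s` and `-s` are both replaced by their residuals; the smallness of
  -- each residual thus counts twice.
  have h := integral_energy_sub_exp (expCoeff (q + 1) s) (expCoeff (q + 1) (-s))
    (fun x => hasDerivAt_expGen_piece (q + 1) s x) (fun x => hasDerivAt_expGen_piece (q + 1) (-s) x)
    (hd s) (hd (-s)) (expGen_piece_succ_one q s)
    (by have := expGen_piece_succ_one q (-s); simpa using this)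
  rw [symbol_intFunctional, symbol_intFunctional, ← intervalIntegral.integral_const_mul,
    ← intervalIntegral.integral_sub
      (Continuous.intervalIntegrable (by fun_prop) _ _)
      (Continuous.intervalIntegrable (by fun_prop) _ _), h]
  have e : ∀ x : ℝ, expGen (q + 1) (dpiece (q + 1)) (-s) x + expCoeff (q + 1) (-s) *
      (Complex.I * s) * Complex.exp (-(Complex.I * s * x)) =
      (1 - Complex.exp (-(Complex.I * (-s : ℝ)))) * residual q (-s) x := fun x => by
    rw [← dpiece_sub_exp hns]
    push_cast
    rw [mul_neg, neg_mul]
    ring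
  have e' : ∀ x : ℝ, expGen (q + 1) (piece (q + 1)) (-s) x - expCoeff (q + 1) (-s) *
      Complex.exp (-(Complex.I * s * x)) = residual (q + 1) (-s) x := fun x => by
    rw [residual]
    push_cast
    rw [mul_neg, neg_mul]
  have e'' : ∀ x : ℝ, expGen (q + 1) (piece (q + 1)) s x - expCoeff (q + 1) s *
      Complex.exp (Complex.I * s * x) = residual (q + 1) s x := fun x => rfl
  simp only [dpiece_sub_exp hs0, e, e', e'']
  have hb := intervalIntegral.norm_integral_le_of_norm_le_const (a := (0 : ℝ)) (b := 1)
    (f := fun x : ℝ => (1 - Complex.exp (-(Complex.I * s))) * residual q s x *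
        ((1 - Complex.exp (-(Complex.I * (-s : ℝ)))) * residual q (-s) x) -
      (s : ℂ) ^ 2 * (residual (q + 1) s x * residual (q + 1) (-s) x))
    (C := 2 * 4 ^ (q + 1) * ‖s ^ (2 * q + 4)‖) (fun x hx => by
      rw [Set.uIoc_of_le zero_le_one] at hx
      have hx' : x ∈ Set.Icc (0 : ℝ) 1 := ⟨hx.1.le, hx.2⟩
      have b1 := (residual_bound hs0 hs q).1 x hx'
      have b2 := (residual_bound hns hs' q).1 x hx'
      have b3 := (residual_bound hs0 hs (q + 1)).1 x hx'
      have b4 := (residual_bound hns hs' (q + 1)).1 x hx'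
      have c1 := norm_one_sub_exp_le s
      have c2 := norm_one_sub_exp_le (-s)
      rw [abs_neg] at b2 b4 c2
      have hsn := abs_nonneg s
      have hle : (2 * |s|) ^ (q + 1 + 1) ≤ (2 * |s|) ^ (q + 1) :=
        pow_le_pow_of_le_one (by positivity) (by linarith) (by omega)
      refine (norm_sub_le _ _).trans ?_
      have t1 : ‖(1 - Complex.exp (-(Complex.I * s))) * residual q s x *
          ((1 - Complex.exp (-(Complex.I * (-s : ℝ)))) * residual q (-s) x)‖ ≤
          |s| * (2 * |s|) ^ (q + 1) * (|s| * (2 * |s|) ^ (q + 1)) := by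
        simp only [norm_mul]
        gcongr
      have t2 : ‖(s : ℂ) ^ 2 * (residual (q + 1) s x * residual (q + 1) (-s) x)‖ ≤
          |s| ^ 2 * ((2 * |s|) ^ (q + 1) * (2 * |s|) ^ (q + 1)) := by
        simp only [norm_mul, norm_pow, Complex.norm_real, Real.norm_eq_abs]
        gcongr
        · exact b3.trans hle
        · exact b4.trans hle
      refine (add_le_add t1 t2).trans_eq ?_
      have h4 : (4 : ℝ) ^ (q + 1) = 2 ^ (2 * (q + 1)) := by rw [pow_mul]; norm_num
      rw [norm_pow, Real.norm_eq_abs, h4]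
      ring)
  simpa using hb

/-! ### Defects: Taylor coefficients of the dispersion error -/

/-- The Taylor coefficients of the dispersion error, up to powers of the imaginary unit. -/
noncomputable def defect (L : ℝ[X] →ₗ[ℝ] ℝ) (p r : ℕ) : ℝ :=
  moment L p (dpiece p) (r + 2) / ((r + 2).factorial : ℝ) +
    moment L p (piece p) r / (r.factorial : ℝ)

lemma moment_zero (L : ℝ[X] →ₗ[ℝ] ℝ) (p : ℕ) (F : ℤ → ℝ[X]) :
    moment L p F 0 =
      L ((∑ m ∈ Finset.range (p + 1), F m) * ∑ m ∈ Finset.range (p + 1), F m) := by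
  rw [Finset.sum_mul_sum, map_sum, moment, corr]
  refine Finset.sum_congr rfl fun m _ => ?_
  rw [map_sum]
  simp

lemma moment_piece_zero (L : ℝ[X] →ₗ[ℝ] ℝ) (p : ℕ) : moment L p (piece p) 0 = L 1 := by
  rw [moment_zero, sum_piece, one_mul]

lemma moment_dpiece_zero (L : ℝ[X] →ₗ[ℝ] ℝ) (p : ℕ) : moment L p (dpiece p) 0 = 0 := by
  have : ∑ m ∈ Finset.range (p + 1), dpiece p m = 0 := by
    simp only [dpiece]
    rw [← derivative_sum, sum_piece, derivative_one]
  rw [moment_zero, this]; simp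

lemma defect_of_odd (L : ℝ[X] →ₗ[ℝ] ℝ) (p : ℕ) {r : ℕ} (hr : Odd r) : defect L p r = 0 := by
  rw [defect, moment_of_odd _ _ _ hr, moment_of_odd _ _ _ (hr.add_even even_two)]; simp

/-- Since `s ^ 2 = -(i s) ^ 2`, the mass expansion moves up by two orders and adds to the stiffness
expansion. The latter starts at order two: the derivatives of a partition of unity sum to zero, and
odd moments vanish. -/
lemma dispersion_sub_taylor_isBigO (L : ℝ[X] →ₗ[ℝ] ℝ) (p n : ℕ) :
    (fun s : ℝ => symbol L p (dpiece p) s - (s : ℂ) ^ 2 * symbol L p (piece p) s -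
      ∑ r ∈ Finset.range n, (Complex.I * s) ^ (r + 2) * (defect L p r : ℂ))
      =O[𝓝 0] fun s => s ^ (n + 2) := by
  have h1 := symbol_sub_taylor_isBigO L p (dpiece p) (n + 2)
  have h2 : (fun s : ℝ => (s : ℂ) ^ 2 * (symbol L p (piece p) s -
      ∑ r ∈ Finset.range n, (Complex.I * s) ^ r / (r.factorial : ℂ) *
        (moment L p (piece p) r : ℂ))) =O[𝓝 0] fun s : ℝ => s ^ (n + 2) := by
    have h := symbol_sub_taylor_isBigO L p (piece p) n
    have hs : (fun s : ℝ => (s : ℂ) ^ 2) =O[𝓝 0] fun s : ℝ => s ^ 2 :=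
      Asymptotics.IsBigO.of_bound 1 (Eventually.of_forall fun s => by simp)
    refine (hs.mul h).congr_right fun s => ?_
    ring
  refine (h1.sub h2).congr_left fun s => ?_
  rw [Finset.sum_range_succ', Finset.sum_range_succ', moment_dpiece_zero,
    moment_of_odd L p (dpiece p) (r := 0 + 1) (by simp)]
  simp only [Complex.ofReal_zero, mul_zero, add_zero, mul_sub, Finset.mul_sum]
  have : ∀ r, (Complex.I * s) ^ (r + 2) * (defect L p r : ℂ) =
      (Complex.I * s) ^ (r + 1 + 1) / ((r + 1 + 1).factorial : ℂ) *
        (moment L p (dpiece p) (r + 1 + 1) : ℂ) -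
      (s : ℂ) ^ 2 * ((Complex.I * s) ^ r / (r.factorial : ℂ) * (moment L p (piece p) r : ℂ)) := by
    intro r
    rw [defect]
    push_cast
    linear_combination (s : ℂ) ^ 2 * (Complex.I * s) ^ r / (r.factorial : ℂ) *
      (moment L p (piece p) r : ℂ) * Complex.I_sq
  simp only [this, Finset.sum_sub_distrib]
  ring

lemma defect_intFunctional {q r : ℕ} (hr : r < 2 * q + 2) :
    defect intFunctional (q + 1) r = 0 := by
  have h1 := symbol_intFunctional_isBigO q
  have h2 := (dispersion_sub_taylor_isBigO intFunctional (q + 1) (2 * q + 2)).mono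
    (nhdsWithin_le_nhds (s := {0}ᶜ))
  have h3 := eq_zero_of_sum_isBigO (c := fun r => if r < 2 then 0 else
      Complex.I ^ r * defect intFunctional (q + 1) (r - 2))
    (2 * q + 4) ((h1.sub h2).congr_left fun s => by
      rw [sub_sub_cancel, show 2 * q + 4 = 2 * q + 2 + 1 + 1 by rfl, Finset.sum_range_succ' _ (2 * q + 2 + 1),
        Finset.sum_range_succ' _ (2 * q + 2)]
      rw [if_pos (show 0 + 1 < 2 by norm_num), if_pos (show 0 < 2 by norm_num), zero_mul, zero_mul,
        add_zero, add_zero]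
      refine Finset.sum_congr rfl fun r _ => ?_
      rw [if_neg (by omega), mul_pow, show r + 1 + 1 - 2 = r by omega]; ring) (r + 2) (by omega)
  rw [if_neg (by omega)] at h3
  simpa using h3

lemma natDegree_dpiece_le (q : ℕ) (i : ℤ) : (dpiece (q + 1) i).natDegree ≤ q := by
  have := natDegree_derivative_le (piece (q + 1) i)
  have := natDegree_piece_le (q + 1) i
  rw [dpiece]; omega

lemma moment_sub_intFunctional (L : ℝ[X] →ₗ[ℝ] ℝ) (p : ℕ) (F : ℤ → ℝ[X]) (r : ℕ) :
    moment (L - intFunctional) p F r = moment L p F r - moment intFunctional p F r :=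
  corr_sub _ _ _ _ _

section Exact

variable {L : ℝ[X] →ₗ[ℝ] ℝ} {q : ℕ}

lemma moment_dpiece_of_exact
    (hL : ∀ f : ℝ[X], f.natDegree ≤ 2 * q → L f = intFunctional f)
    (r : ℕ) : moment L (q + 1) (dpiece (q + 1)) r =
    moment intFunctional (q + 1) (dpiece (q + 1)) r :=
  corr_congr hL (natDegree_dpiece_le q) le_rfl _

lemma sub_intFunctional_eq_zero
    (hL : ∀ f : ℝ[X], f.natDegree ≤ 2 * q → L f = intFunctional f)
    (f : ℝ[X]) (hf : f.natDegree ≤ 2 * q) :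
    (L - intFunctional) f = 0 := by
  rw [LinearMap.sub_apply, hL f hf, sub_self]

/-- Below order `2 * q + 2` neither family of moments sees the quadrature error: stiffness products
have degree at most `2 * q`, and the mass error has vanishing moments there. -/
lemma defect_eq_zero
    (hL : ∀ f : ℝ[X], f.natDegree ≤ 2 * q → L f = intFunctional f)
    {r : ℕ} (hr : r < 2 * q + 2) : defect L (q + 1) r = 0 := by
  have h := moment_annihilates_piece (sub_intFunctional_eq_zero hL) hr
  rw [moment_sub_intFunctional, sub_eq_zero] at h
  rw [defect, moment_dpiece_of_exact hL, h]
  exact defect_intFunctional hr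

/-- The dispersion error of a rule whose defect of order `2 * q + 2` is zero. -/
lemma dispersion_isBigO
    (hL : ∀ f : ℝ[X], f.natDegree ≤ 2 * q → L f = intFunctional f)
    (h0 : defect L (q + 1) (2 * q + 2) = 0) :
    (fun s : ℝ => symbol L (q + 1) (dpiece (q + 1)) s -
      (s : ℂ) ^ 2 * symbol L (q + 1) (piece (q + 1)) s -
      (-1) ^ (q + 1) * (defect L (q + 1) (2 * q + 4) : ℂ) * (s : ℂ) ^ (2 * q + 6))
      =O[𝓝 0] fun s => s ^ (2 * q + 8) := by
  refine (dispersion_sub_taylor_isBigO L (q + 1) (2 * q + 6)).congr_left fun s => ?_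
  congr 1
  -- Orders `2 * q + 2` to `2 * q + 5` are split off: the first vanishes by `h0`, the two odd ones
  -- by symmetry, and only `2 * q + 4` survives.
  rw [Finset.sum_range_succ, Finset.sum_range_succ, Finset.sum_range_succ, Finset.sum_range_succ,
    Finset.sum_eq_zero fun r hr => ?_, h0, defect_of_odd L _ (r := 2 * q + 3) ⟨q + 1, by ring⟩,
    defect_of_odd L _ (r := 2 * q + 5) ⟨q + 2, by ring⟩]
  · have : (Complex.I * s) ^ (2 * q + 4 + 2) = (-1) ^ (q + 1) * (s : ℂ) ^ (2 * q + 6) := by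
      rw [mul_pow, show 2 * q + 4 + 2 = 2 * (q + 3) by ring, pow_mul, Complex.I_sq]; ring
    rw [this]
    simp
    ring
  · rw [defect_eq_zero hL (Finset.mem_range.mp hr)]; simp

lemma symbol_piece_sub_one_isBigO
    (hL : ∀ f : ℝ[X], f.natDegree ≤ 2 * q → L f = intFunctional f) :
    (fun s : ℝ => symbol L (q + 1) (piece (q + 1)) s - 1) =O[𝓝 0] fun s => s ^ 2 := by
  refine (symbol_sub_taylor_isBigO L (q + 1) (piece (q + 1)) 2).congr_left fun s => ?_
  have h1 : L 1 = 1 := by rw [hL 1 (by simp)]; simp [intFunctional]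
  rw [Finset.sum_range_succ, Finset.sum_range_succ, moment_piece_zero, h1,
    moment_of_odd _ _ _ odd_one]
  simp

end Exact

/-! ### Zeros and orthogonality of the shifted Legendre polynomials -/

lemma roots_card_le_iterate_derivative (f : ℝ[X]) (n : ℕ) :
    f.roots.card ≤ (derivative^[n] f).roots.card + n := by
  induction n with
  | zero => simp
  | succ n ih =>
    have := card_roots_le_derivative (derivative^[n] f)
    rw [Function.iterate_succ_apply']; omega

/-- The polynomial whose `m`-th derivative is a multiple of the shifted Legendre polynomial. -/
noncomputable def rodrigues (m : ℕ) : ℝ[X] := X ^ m * (1 - X) ^ m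

/-- The shifted Legendre polynomial with real coefficients. -/
noncomputable def legendre (m : ℕ) : ℝ[X] :=
  (shiftedLegendre m).map (Int.castRingHom ℝ)

lemma derivative_rodrigues (m : ℕ) :
    derivative^[m] (rodrigues m) = C (m.factorial : ℝ) * legendre m := by
  have h := congrArg (Polynomial.map (Int.castRingHom ℝ)) (factorial_mul_shiftedLegendre_eq m)
  rw [← iterate_derivative_map] at h
  simpa [rodrigues, legendre] using h.symm

lemma eval_derivative_rodrigues {m k : ℕ} (hk : k < m) :
    (derivative^[k] (rodrigues m)).eval 0 = 0 ∧ (derivative^[k] (rodrigues m)).eval 1 = 0 := by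
  have key : ∀ f : ℝ[X], f ^ m ∣ rodrigues m → ∀ x : ℝ, f.eval x = 0 →
      (derivative^[k] (rodrigues m)).eval x = 0 := fun f hf x hx => by
    obtain ⟨g, hg⟩ := pow_sub_dvd_iterate_derivative_of_pow_dvd k hf
    rw [hg, eval_mul, eval_pow, hx, zero_pow (by omega), zero_mul]
  exact ⟨key X (Dvd.intro _ rfl) 0 (by simp), key (1 - X) (Dvd.intro_left _ rfl) 1 (by simp)⟩

lemma intFunctional_derivative_mul (f g : ℝ[X]) :
    intFunctional (derivative f * g) = f.eval 1 * g.eval 1 - f.eval 0 * g.eval 0 -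
      intFunctional (f * derivative g) := by
  have h := intervalIntegral.integral_eq_sub_of_hasDerivAt (a := (0 : ℝ)) (b := 1)
    (fun x _ => (f * g).hasDerivAt x) ((derivative (f * g)).continuous.intervalIntegrable _ _)
  rw [← intFunctional_apply, derivative_mul, map_add, eval_mul, eval_mul] at h
  linarith

lemma intFunctional_iterate_derivative_mul {m k : ℕ} (hk : k ≤ m) (g : ℝ[X]) :
    intFunctional (derivative^[k] (rodrigues m) * g) =
      (-1) ^ k * intFunctional (rodrigues m * derivative^[k] g) := by
  induction k generalizing g with
  | zero => simp
  | succ k ih =>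
    obtain ⟨h0, h1⟩ := eval_derivative_rodrigues (m := m) (k := k) (by omega)
    rw [Function.iterate_succ_apply', intFunctional_derivative_mul, h0, h1, ih (by omega),
      ← Function.iterate_succ_apply]
    ring

lemma intFunctional_legendre_mul {m : ℕ} {g : ℝ[X]} (hg : g.natDegree < m) :
    intFunctional (legendre m * g) = 0 := by
  have h := intFunctional_iterate_derivative_mul (le_refl m) g
  rw [iterate_derivative_eq_zero hg, mul_zero, map_zero, mul_zero, derivative_rodrigues, mul_assoc,
    C_mul', map_smul, smul_eq_mul, mul_eq_zero] at h
  exact h.resolve_left (by exact_mod_cast m.factorial_ne_zero)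

lemma natDegree_legendre (m : ℕ) : (legendre m).natDegree = m := by
  rw [legendre, natDegree_map_eq_of_injective (by exact Int.cast_injective),
    natDegree_shiftedLegendre]

lemma legendre_ne_zero (m : ℕ) : legendre m ≠ 0 := by
  intro h
  have h1 := degree_map_eq_of_injective (f := Int.castRingHom ℝ) Int.cast_injective
    (shiftedLegendre m)
  rw [← legendre, h, degree_shiftedLegendre, degree_zero] at h1
  simp at h1

/-- Rolle with multiplicities: `rodrigues m` has `2 * m` real roots, and each of the `m`
differentiations loses at most one. -/
lemma card_roots_legendre (m : ℕ) : (legendre m).roots.card = m := by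
  refine le_antisymm ((card_roots' _).trans (natDegree_legendre m).le) ?_
  have h := roots_card_le_iterate_derivative (rodrigues m) m
  rw [derivative_rodrigues, roots_C_mul _ (by exact_mod_cast m.factorial_ne_zero)] at h
  have e : rodrigues m = C ((-1) ^ m) * (X ^ m * (X - C 1) ^ m) := by
    rw [rodrigues, ← neg_sub (X : ℝ[X]) 1, neg_pow (X - 1 : ℝ[X])]
    simp; ring
  have : (rodrigues m).roots.card = 2 * m := by
    rw [e, roots_C_mul _ (by simp), roots_mul, roots_X_pow, roots_pow, roots_X_sub_C]
    · simp; ring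
    · exact mul_ne_zero (pow_ne_zero _ X_ne_zero) (pow_ne_zero _ (X_sub_C_ne_zero _))
  omega

lemma intFunctional_pos {f : ℝ[X]} (hf : f ≠ 0) (hnn : ∀ x ∈ Set.Icc (0 : ℝ) 1, 0 ≤ f.eval x) :
    0 < intFunctional f := by
  rw [intFunctional_apply]
  refine intervalIntegral.integral_pos zero_lt_one f.continuous.continuousOn
    (fun x hx => hnn x ⟨hx.1.le, hx.2⟩) ?_
  by_contra! h
  refine hf (eq_zero_of_infinite_isRoot f ((Set.Icc_infinite (zero_lt_one' ℝ)).mono fun x hx => ?_))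
  exact le_antisymm (h x hx) (hnn x hx)

/-- For a root `r` outside the interval, write the polynomial as `(X - r) * g`. Its product with `g`
has one sign on `[0, 1]`, which contradicts orthogonality to lower degrees. -/
lemma mem_Icc_of_mem_roots_legendre {m : ℕ} {r : ℝ} (hr : r ∈ (legendre m).roots) :
    r ∈ Set.Icc (0 : ℝ) 1 := by
  obtain ⟨g, hg⟩ := dvd_iff_isRoot.mpr (isRoot_of_mem_roots hr)
  have hg0 : g ≠ 0 := by rintro rfl; exact legendre_ne_zero m (by rw [hg, mul_zero])
  have hdeg : g.natDegree < m := by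
    have := natDegree_legendre m
    rw [hg, natDegree_mul (X_sub_C_ne_zero _) hg0, natDegree_X_sub_C] at this; omega
  have h := intFunctional_legendre_mul hdeg
  rw [hg, mul_assoc] at h
  by_contra hr'
  rw [Set.mem_Icc, not_and_or, not_le, not_le] at hr'
  rcases hr' with h' | h'
  · refine (intFunctional_pos (mul_ne_zero (X_sub_C_ne_zero r) (mul_ne_zero hg0 hg0)) ?_).ne' h
    intro x hx
    rw [eval_mul, eval_mul]
    refine mul_nonneg ?_ (mul_self_nonneg _)
    simp; linarith [hx.1]
  · refine (intFunctional_pos (f := -((X - C r) * (g * g)))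
      (neg_ne_zero.mpr (mul_ne_zero (X_sub_C_ne_zero r) (mul_ne_zero hg0 hg0))) ?_).ne'
      (by rw [map_neg, h, neg_zero])
    intro x hx
    rw [eval_neg, eval_mul, eval_mul, ← neg_mul]
    refine mul_nonneg ?_ (mul_self_nonneg _)
    simp; linarith [hx.2]

/-- A double root `r` would give `(X - r) ^ 2 * g`, whose product with `g` is nonnegative although
`g` has lower degree. -/
lemma nodup_roots_legendre (m : ℕ) : (legendre m).roots.Nodup := by
  rw [Multiset.nodup_iff_count_le_one]
  intro r
  rw [count_roots]
  by_contra! h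
  obtain ⟨g, hg⟩ := (pow_dvd_pow (X - C r) h).trans (pow_rootMultiplicity_dvd (legendre m) r)
  have hg0 : g ≠ 0 := by rintro rfl; exact legendre_ne_zero m (by rw [hg, mul_zero])
  have hX := X_sub_C_ne_zero r
  have hdeg : g.natDegree < m := by
    have := natDegree_legendre m
    rw [hg, natDegree_mul (pow_ne_zero _ hX) hg0, natDegree_pow, natDegree_X_sub_C] at this; omega
  have hz := intFunctional_legendre_mul hdeg
  rw [hg] at hz
  refine (intFunctional_pos (mul_ne_zero (mul_ne_zero (pow_ne_zero _ hX) hg0) hg0) ?_).ne' hz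
  intro x _
  rw [mul_assoc, eval_mul, eval_mul, eval_pow]
  exact mul_nonneg (even_two.pow_nonneg _) (mul_self_nonneg _)

lemma card_gaussNodes (m : ℕ) : (gaussNodes m).card = m := by
  exact (Multiset.toFinset_card_of_nodup (nodup_roots_legendre m)).trans (card_roots_legendre m)

/-! ### Quadrature rules as functionals, and exactness of the Gauss rule -/

/-- The value of a rule as a functional on polynomials. -/
noncomputable def ruleFunctional (Q : QuadRule) : ℝ[X] →ₗ[ℝ] ℝ where
  toFun f := Q.apply fun t => f.eval t
  map_add' f g := by simp [QuadRule.apply, mul_add, Finsupp.sum_add]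
  map_smul' c f := by
    simp only [QuadRule.apply, eval_smul, Finsupp.sum, Finset.smul_sum, RingHom.id_apply]
    exact Finset.sum_congr rfl fun n _ => smul_comm _ _ _

lemma ruleFunctional_apply (Q : QuadRule) (f : ℝ[X]) :
    ruleFunctional Q f = Q.apply fun t => f.eval t := rfl

lemma ruleFunctional_add (Q R : QuadRule) :
    ruleFunctional (Q + R) = ruleFunctional Q + ruleFunctional R := by
  refine LinearMap.ext fun f => ?_
  rw [LinearMap.add_apply]
  simp only [ruleFunctional_apply, QuadRule.apply]
  exact Finsupp.sum_add_index' (by simp) (by simp [add_mul])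

lemma ruleFunctional_smul (c : ℝ) (Q : QuadRule) :
    ruleFunctional (c • Q) = c • ruleFunctional Q := by
  refine LinearMap.ext fun f => ?_
  rw [LinearMap.smul_apply, ruleFunctional_apply, ruleFunctional_apply, QuadRule.apply,
    Finsupp.sum_smul_index (by simp), QuadRule.apply, Finsupp.smul_sum]
  simp [mul_assoc]

lemma ruleFunctional_gaussRule (m : ℕ) (f : ℝ[X]) : ruleFunctional (gaussRule m) f =
    ∑ n ∈ gaussNodes m, intFunctional (Lagrange.basis (gaussNodes m) id n) * f.eval n := by
  rw [ruleFunctional_apply, QuadRule.apply, gaussRule, ← Finsupp.sum_finsetSum_index]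
  · refine Finset.sum_congr rfl fun n _ => ?_
    rw [Finsupp.sum_single_index (by simp), smul_eq_mul, intFunctional_apply]
  · simp
  · simp [add_mul]

/-- Divide by the Legendre polynomial. The quotient part integrates to zero by orthogonality and
vanishes at the nodes; the remainder has degree below `m` and equals its Lagrange interpolant. -/
lemma gaussRule_exact {m : ℕ} {f : ℝ[X]} (hf : f.natDegree < 2 * m) :
    ruleFunctional (gaussRule m) f = intFunctional f := by
  have hL := legendre_ne_zero m
  have hroot : ∀ n ∈ gaussNodes m, (legendre m).eval n = 0 := fun n hn =>
    isRoot_of_mem_roots (Multiset.mem_toFinset.mp hn)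
  have hm : (f % legendre m).degree < (gaussNodes m).card := by
    have h : (f % legendre m).degree < (legendre m).degree := EuclideanDomain.mod_lt f hL
    rwa [degree_eq_natDegree hL, natDegree_legendre, ← congrArg Nat.cast (card_gaussNodes m)] at h
  have hdiv := EuclideanDomain.div_add_mod f (legendre m)
  have hq : (f / legendre m).natDegree < m := by
    by_cases h0 : f / legendre m = 0
    · rw [h0, natDegree_zero]; omega
    · have h1 : (f % legendre m).natDegree ≤ m := by
        refine natDegree_le_of_degree_le (hm.le.trans ?_)
        rw [card_gaussNodes]
      have h2 : legendre m * (f / legendre m) = f - f % legendre m := by linear_combination hdiv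
      have h3 := natDegree_mul hL h0
      rw [h2, natDegree_legendre] at h3
      have h4 := natDegree_sub_le f (f % legendre m)
      omega
  have h1 : intFunctional f = intFunctional (f % legendre m) := by
    conv_lhs => rw [← hdiv]
    rw [map_add, intFunctional_legendre_mul hq, zero_add]
  have h2 := Lagrange.eq_interpolate (v := id) (s := gaussNodes m) Function.injective_id.injOn hm
  rw [h1, ruleFunctional_gaussRule]
  conv_rhs => rw [h2, Lagrange.interpolate_apply]
  rw [map_sum]
  refine Finset.sum_congr rfl fun n hn => ?_
  have h3 : f.eval n = (f % legendre m).eval n := by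
    conv_lhs => rw [← hdiv]
    rw [eval_add, eval_mul, hroot n hn, zero_mul, zero_add]
  rw [C_mul', map_smul, smul_eq_mul, h3, mul_comm]
  rfl

lemma nodesInElement_gaussRule (m : ℕ) : (gaussRule m).NodesInElement := by
  intro n hn
  obtain ⟨r, hr, hr'⟩ := Finset.mem_biUnion.mp (Finsupp.support_finsetSum hn)
  have : n = r := by simpa using Finsupp.support_single_subset hr'
  subst this
  exact mem_Icc_of_mem_roots_legendre (Multiset.mem_toFinset.mp hr)

lemma nodesInElement_blend {p : ℕ} {Q : QuadRule} (hQ : Q.NodesInElement) (τ : ℝ) :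
    (blend p Q τ).NodesInElement := by
  intro n hn
  rcases Finset.mem_union.mp (Finsupp.support_add hn) with h | h
  · exact nodesInElement_gaussRule _ n (Finsupp.support_smul h)
  · exact hQ n (Finsupp.support_smul h)

/-! ### The discrete bilinear forms on the mesh as correlations -/

lemma theta_eq_piece_of_mem_Ico (p : ℕ) {h : ℝ} (hh : 0 < h) (j e : ℤ) {x : ℝ}
    (hx : x ∈ Set.Ico (0 : ℝ) 1) : theta p h j ((e + x) * h) = (piece p (e - j)).eval x := by
  unfold theta
  induction p generalizing j with
  | zero =>
    rw [bspline, piece]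
    have : ((j : ℝ) * h ≤ (e + x) * h ∧ (e + x) * h < ((j + 1 : ℤ) : ℝ) * h) ↔ e - j = 0 := by
      rw [mul_le_mul_iff_of_pos_right hh, mul_lt_mul_iff_of_pos_right hh]
      push_cast
      constructor
      · rintro ⟨h1, h2⟩
        have h3 : (j : ℝ) < e + 1 := by linarith [hx.2]
        have h4 : (e : ℝ) < j + 1 := by linarith [hx.1]
        norm_cast at h3 h4
        omega
      · intro h0
        have : (e : ℝ) = j := by exact_mod_cast (by omega : e = j)
        rw [this]
        exact ⟨by linarith [hx.1], by linarith [hx.2]⟩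
    simp only [this]
    split_ifs <;> simp
  | succ p ih =>
    rw [bspline, ih, ih, piece, show e - (j + 1) = e - j - 1 by ring]
    simp only [eval_mul, eval_add, eval_sub, eval_C, eval_X]
    push_cast
    have hp : (p : ℝ) + 1 ≠ 0 := by positivity
    have h1 : ((j : ℝ) + (p + 1)) * h - j * h = (p + 1) * h := by ring
    have h2 : ((j : ℝ) + (p + 1) + 1) * h - (j + 1) * h = (p + 1) * h := by ring
    rw [h1, h2]
    have := hh.ne'
    field_simp
    ring

/-- Rules may have nodes at the right end point, which the half-open convention assigns to the next
element; continuity, available from degree one on, closes the gap. -/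
lemma theta_eq_piece (p : ℕ) {h : ℝ} (hh : 0 < h) (j e : ℤ) {x : ℝ}
    (hx : x ∈ Set.Icc (0 : ℝ) 1) :
    theta (p + 1) h j ((e + x) * h) = (piece (p + 1) (e - j)).eval x := by
  rcases hx.2.lt_or_eq with h1 | rfl
  · exact theta_eq_piece_of_mem_Ico _ hh j e ⟨hx.1, h1⟩
  · have := theta_eq_piece_of_mem_Ico (p + 1) hh j (e + 1) (x := 0) (by simp)
    rw [eval_one_piece, show e - j + 1 = e + 1 - j by ring, ← this]
    push_cast; rw [add_zero]

lemma theta_eq_zero (p : ℕ) {h : ℝ} (hh : 0 < h) (j : ℤ) {t : ℝ}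
    (ht : t < j * h ∨ ((j : ℝ) + (p + 1)) * h ≤ t) : theta p h j t = 0 := by
  have e : t = ((⌊t / h⌋ : ℝ) + Int.fract (t / h)) * h := by
    rw [Int.floor_add_fract]; field_simp
  rw [e, theta_eq_piece_of_mem_Ico p hh j _ ⟨Int.fract_nonneg _, Int.fract_lt_one _⟩,
    piece_eq_zero, eval_zero]
  rcases ht with ht | ht
  · left
    have : ⌊t / h⌋ < j := Int.floor_lt.mpr ((div_lt_iff₀ hh).mpr ht)
    omega
  · right
    have : j + (p + 1) ≤ ⌊t / h⌋ := Int.le_floor.mpr (by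
      push_cast; exact (le_div_iff₀ hh).mpr ht)
    omega

lemma finsum_eq_sum_range_add {M : Type*} [AddCommMonoid M] {f : ℤ → M} (a : ℤ) (p : ℕ)
    (hf : ∀ k, k - a < 0 ∨ (p : ℤ) < k - a → f k = 0) :
    ∑ᶠ k, f k = ∑ m ∈ Finset.range (p + 1), f (a + m) := by
  rw [finsum_eq_sum_of_support_subset (s := (Finset.range (p + 1)).image fun m : ℕ => a + (m : ℤ))]
  · rw [Finset.sum_image]
    intro x _ y _ hxy
    simpa using hxy
  · intro k hk
    have : ¬(k - a < 0 ∨ (p : ℤ) < k - a) := fun h => hk (hf k h)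
    simp only [Finset.coe_image, Set.mem_image, Finset.coe_range, Set.mem_Iio]
    exact ⟨(k - a).toNat, by omega, by omega⟩

lemma finsum_eq_sum_range_sub {M : Type*} [AddCommMonoid M] {f : ℤ → M} (a : ℤ) (p : ℕ)
    (hf : ∀ k, a - k < 0 ∨ (p : ℤ) < a - k → f k = 0) :
    ∑ᶠ k, f k = ∑ m ∈ Finset.range (p + 1), f (a - m) := by
  rw [← finsum_comp_equiv (Equiv.neg ℤ), finsum_eq_sum_range_add (-a) p]
  · refine Finset.sum_congr rfl fun m _ => ?_
    rw [Equiv.neg_apply, neg_add, neg_neg, sub_eq_add_neg]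
  · intro k hk
    exact hf _ (by rw [Equiv.neg_apply]; omega)

section Rule

variable {E : Type*} [NormedAddCommGroup E] [NormedSpace ℝ E]

/-- On every element of the mesh of size `h`, the function `v` is the combination of the pieces
of the B-splines of degree `p` with the coefficients `U`. -/
def IsSplineWith (p : ℕ) (h : ℝ) (U : ℤ → E) (v : ℝ → E) : Prop :=
  ∀ e : ℤ, ∀ x ∈ Set.Icc (0 : ℝ) 1,
    v ((e + x) * h) = ∑ l ∈ Finset.range (p + 1), (piece p l).eval x • U (e - l)

lemma sum_smul_single {p : ℕ} {F : ℤ → ℝ[X]} (hF : ∀ i, i < 0 ∨ (p : ℤ) < i → F i = 0)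
    (j e : ℤ) (x : ℝ) : ∑ l ∈ Finset.range (p + 1), (F l).eval x •
      (Pi.single j 1 : ℤ → ℝ) (e - l) = (F (e - j)).eval x := by
  simp only [Pi.single_apply, smul_eq_mul, mul_ite, mul_one, mul_zero]
  by_cases hk : e - j < 0 ∨ (p : ℤ) < e - j
  · rw [hF _ hk, eval_zero]
    refine Finset.sum_eq_zero fun l hl => ?_
    rw [Finset.mem_range] at hl
    rw [if_neg (by omega)]
  · rw [Finset.sum_eq_single (e - j).toNat]
    · rw [if_pos (by omega), Int.toNat_of_nonneg (by omega)]
    · intro l _ hl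
      rw [if_neg (by omega)]
    · intro hl
      rw [Finset.mem_range] at hl
      omega

lemma dpiece_eq_zero {p : ℕ} {i : ℤ} (hi : i < 0 ∨ (p : ℤ) < i) : dpiece p i = 0 := by
  rw [dpiece, piece_eq_zero hi, derivative_zero]

lemma isSplineWith_theta (p : ℕ) {h : ℝ} (hh : 0 < h) (j : ℤ) :
    IsSplineWith (p + 1) h (Pi.single j 1) (theta (p + 1) h j) := fun e x hx => by
  rw [sum_smul_single (fun _ => piece_eq_zero), theta_eq_piece p hh j e hx]

lemma isSplineWith_spline (p : ℕ) {h : ℝ} (hh : 0 < h) (U : ℤ → ℂ) :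
    IsSplineWith (p + 1) h U (spline (p + 1) h U) := fun e x hx => by
  rw [spline, finsum_eq_sum_range_sub e (p + 1)]
  · refine Finset.sum_congr rfl fun l _ => ?_
    rw [theta_eq_piece p hh _ e hx, sub_sub_cancel]
  · intro k hk
    rw [theta_eq_piece p hh _ e hx, piece_eq_zero hk, eval_zero, zero_smul]

lemma IsSplineWith.derivWithin_eq {p : ℕ} {h : ℝ} (hh : 0 < h) {U : ℤ → E} {v : ℝ → E}
    (hv : IsSplineWith p h U v) (e : ℤ) {x : ℝ} (hx : x ∈ Set.Icc (0 : ℝ) 1) :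
    derivWithin v (element h e) ((e + x) * h) =
      h⁻¹ • ∑ l ∈ Finset.range (p + 1), (dpiece p l).eval x • U (e - l) := by
  have hx' : (e + x) * h ∈ element h e :=
    ⟨mul_le_mul_of_nonneg_right (by linarith [hx.1]) hh.le,
      mul_le_mul_of_nonneg_right (by linarith [hx.2]) hh.le⟩
  have hxe : (e + x) * h / h - e = x := by field_simp; ring
  have hv' : Set.EqOn v (fun t => ∑ l ∈ Finset.range (p + 1),
      (piece p l).eval (t / h - e) • U (e - l)) (element h e) := fun t ht => by
    have h1 := hv e (t / h - e) ⟨by rw [sub_nonneg, le_div_iff₀ hh]; exact ht.1,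
      by rw [sub_le_iff_le_add', div_le_iff₀ hh]; exact ht.2⟩
    rwa [add_sub_cancel, div_mul_cancel₀ _ hh.ne'] at h1
  rw [derivWithin_congr hv' (hv' hx')]
  have hd : HasDerivAt (fun t : ℝ => t / h - e) (1 / h) ((e + x) * h) :=
    ((hasDerivAt_id _).div_const h).sub_const _
  have hs : HasDerivAt (fun t => ∑ l ∈ Finset.range (p + 1),
      (piece p l).eval (t / h - e) • U (e - l)) (∑ l ∈ Finset.range (p + 1),
      ((dpiece p l).eval x * (1 / h)) • U (e - l)) ((e + x) * h) := by
    refine HasDerivAt.fun_sum fun l _ => HasDerivAt.smul_const ?_ _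
    have h1 := (piece p l).hasDerivAt ((e + x) * h / h - e)
    rw [hxe] at h1
    exact HasDerivAt.comp ((e + x) * h) (by rwa [hxe]) hd
  have hu : UniqueDiffWithinAt ℝ (element h e) ((e + x) * h) :=
    uniqueDiffOn_Icc (mul_lt_mul_of_pos_right (lt_add_one _) hh) _ hx'
  rw [hs.hasDerivWithinAt.derivWithin hu, Finset.smul_sum]
  refine Finset.sum_congr rfl fun l _ => ?_
  rw [smul_smul, one_div, mul_comm]

/-- Common to both forms: `c` is `1` for the mass and `h⁻¹`, from the chain rule, for the stiffness.
Only the elements `i + m` with `0 ≤ m ≤ p` meet the support of the test function. -/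
lemma finsum_rule_eq_corr {p : ℕ} {Q : QuadRule} (hQ : Q.NodesInElement) {F : ℤ → ℝ[X]}
    (hF : ∀ i, i < 0 ∨ (p : ℤ) < i → F i = 0) (h c : ℝ) (i : ℤ) (U : ℤ → E)
    {w : ℤ → ℝ → ℝ} {v : ℤ → ℝ → E}
    (hw : ∀ e, ∀ x ∈ Set.Icc (0 : ℝ) 1, w e x = c * (F (e - i)).eval x)
    (hv : ∀ e, ∀ x ∈ Set.Icc (0 : ℝ) 1,
      v e x = c • ∑ l ∈ Finset.range (p + 1), (F l).eval x • U (e - l)) :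
    ∑ᶠ e : ℤ, h • Q.apply (fun x => w e x • v e x) =
      (h * (c * c)) • corr (ruleFunctional Q) p F fun k => U (i + k) := by
  have e1 : ∀ e : ℤ, Q.apply (fun x => w e x • v e x) =
      (c * c) • ∑ l ∈ Finset.range (p + 1), ruleFunctional Q (F (e - i) * F l) • U (e - l) := by
    intro e
    simp only [ruleFunctional_apply, QuadRule.apply, Finsupp.sum, Finset.smul_sum, Finset.sum_smul]
    rw [Finset.sum_comm]
    refine Finset.sum_congr rfl fun n hn => ?_
    rw [hw e n (hQ n hn), hv e n (hQ n hn)]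
    simp only [Finset.smul_sum, smul_smul, eval_mul, smul_eq_mul]
    refine Finset.sum_congr rfl fun l _ => ?_
    congr 1; ring
  simp only [e1]
  rw [finsum_eq_sum_range_add i p, corr, mul_smul, Finset.smul_sum, Finset.smul_sum]
  · refine Finset.sum_congr rfl fun m _ => ?_
    rw [add_sub_cancel_left]
    simp only [add_sub_assoc]
  · intro k hk
    simp [hF _ hk]

lemma formBQ_eq_corr {p : ℕ} {Q : QuadRule} (hQ : Q.NodesInElement) {h : ℝ} (hh : 0 < h) (i : ℤ)
    {U : ℤ → E} {v : ℝ → E} (hv : IsSplineWith (p + 1) h U v) :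
    formBQ Q h (theta (p + 1) h i) v =
      h • corr (ruleFunctional Q) (p + 1) (piece (p + 1)) fun k => U (i + k) := by
  have := finsum_rule_eq_corr (p := p + 1) hQ (fun _ => piece_eq_zero) h 1 i U
    (w := fun e x => theta (p + 1) h i ((e + x) * h)) (v := fun e x => v ((e + x) * h))
    (fun e x hx => by rw [theta_eq_piece p hh i e hx, one_mul])
    (fun e x hx => by rw [hv e x hx, one_smul])
  simpa [formBQ] using this

lemma formAQ_eq_corr {p : ℕ} {Q : QuadRule} (hQ : Q.NodesInElement) {h : ℝ} (hh : 0 < h) (i : ℤ)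
    {U : ℤ → E} {v : ℝ → E} (hv : IsSplineWith (p + 1) h U v) :
    formAQ Q h (theta (p + 1) h i) v =
      h⁻¹ • corr (ruleFunctional Q) (p + 1) (dpiece (p + 1)) fun k => U (i + k) := by
  have := finsum_rule_eq_corr (p := p + 1) hQ (fun _ => dpiece_eq_zero) h h⁻¹ i U
    (w := fun e x => derivWithin (theta (p + 1) h i) (element h e) ((e + x) * h))
    (v := fun e x => derivWithin v (element h e) ((e + x) * h))
    (fun e x hx => by
      rw [(isSplineWith_theta p hh i).derivWithin_eq hh e hx,
        sum_smul_single (fun _ => dpiece_eq_zero), smul_eq_mul])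
    (fun e x hx => hv.derivWithin_eq hh e hx)
  rwa [mul_inv_cancel_left₀ hh.ne'] at this

lemma single_add_comp (j k : ℤ) :
    (fun i => (Pi.single (j + k) 1 : ℤ → ℝ) (j + i)) = Pi.single k 1 := by
  funext i
  simp [Pi.single_apply]

lemma massQ_eq_entry {p : ℕ} {Q : QuadRule} (hQ : Q.NodesInElement) {h : ℝ} (hh : 0 < h)
    (j k : ℤ) : massQ (p + 1) Q h j k = entry (ruleFunctional Q) (p + 1) (piece (p + 1)) k := by
  rw [massQ, formBQ_eq_corr hQ hh j (isSplineWith_theta p hh (j + k)), single_add_comp, smul_eq_mul,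
    mul_div_cancel_left₀ _ hh.ne', entry]

lemma stiffQ_eq_entry {p : ℕ} {Q : QuadRule} (hQ : Q.NodesInElement) {h : ℝ} (hh : 0 < h)
    (j k : ℤ) : stiffQ (p + 1) Q h j k = entry (ruleFunctional Q) (p + 1) (dpiece (p + 1)) k := by
  rw [stiffQ, formAQ_eq_corr hQ hh j (isSplineWith_theta p hh (j + k)), single_add_comp, smul_eq_mul,
    mul_comm, mul_inv_cancel_left₀ hh.ne', entry]

end Rule

/-! ### The exact mass and stiffness entries -/

/-- Only open elements are tested, because mesh points are a null set; kinks of the splines there do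
not matter. -/
lemma integral_eq_sum_intFunctional {g : ℝ → ℝ} {f : ℕ → ℝ[X]} {h : ℝ} (hh : 0 < h) (j : ℤ) (p : ℕ)
    (h0 : ∀ t, t < j * h ∨ ((j : ℝ) + (p + 1)) * h < t → g t = 0)
    (hg : ∀ m < p + 1, ∀ x ∈ Set.Ioo (0 : ℝ) 1, g ((j + m + x) * h) = (f m).eval x) :
    ∫ t, g t = h * ∑ m ∈ Finset.range (p + 1), intFunctional (f m) := by
  set a : ℕ → ℝ := fun m => (j + m) * h with ha
  have hab : ∀ m : ℕ, a m ≤ a (m + 1) := fun m =>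
    mul_le_mul_of_nonneg_right (by push_cast; linarith) hh.le
  have heq : ∀ m < p + 1, Set.EqOn g (fun t => (f m).eval (t / h - (j + m)))
      (Set.Ioo (a m) (a (m + 1))) := fun m hm t ht => by
    have h1 : (j + m : ℝ) < t / h := (lt_div_iff₀ hh).mpr ht.1
    have h2 : t / h < (j + (m + 1 : ℕ) : ℝ) := (div_lt_iff₀ hh).mpr ht.2
    push_cast at h2
    have := hg m hm (t / h - (j + m)) ⟨by linarith, by linarith⟩
    rwa [add_sub_cancel, div_mul_cancel₀ _ hh.ne'] at this
  have hcont : ∀ m, Continuous fun t : ℝ => (f m).eval (t / h - (j + m)) := fun m =>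
    (f m).continuous.comp (by fun_prop)
  rw [← MeasureTheory.setIntegral_eq_integral_of_forall_compl_eq_zero
    (s := Set.Icc (a 0) (a (p + 1))), MeasureTheory.integral_Icc_eq_integral_Ioc,
    ← intervalIntegral.integral_of_le (monotone_nat_of_le_succ hab (Nat.zero_le _)),
    ← intervalIntegral.sum_integral_adjacent_intervals, Finset.mul_sum]
  · refine Finset.sum_congr rfl fun m hm => ?_
    rw [intervalIntegral.integral_congr_Ioo_of_le (hab m) (heq m (Finset.mem_range.mp hm)),
      intervalIntegral.integral_comp_div_sub (fun x => (f m).eval x) hh.ne', smul_eq_mul,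
      intFunctional_apply, ha]
    simp only [mul_div_cancel_right₀ _ hh.ne']
    push_cast
    congr 2 <;> ring
  · intro m hm
    rw [intervalIntegrable_congr_uIoo (g := fun t => (f m).eval (t / h - (j + m)))]
    · exact (hcont m).intervalIntegrable _ _
    · rw [Set.uIoo_of_le (hab m)]
      exact heq m hm
  · intro t ht
    refine h0 t ?_
    rw [Set.mem_Icc, not_and_or, not_le, not_le] at ht
    simpa [ha] using ht

lemma sum_intFunctional_eq_entry {p : ℕ} {F : ℤ → ℝ[X]}
    (hF : ∀ i, i < 0 ∨ (p : ℤ) < i → F i = 0) (k : ℤ) :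
    ∑ m ∈ Finset.range (p + 1), intFunctional (F m * F (m - k)) = entry intFunctional p F k := by
  refine Finset.sum_congr rfl fun m _ => ?_
  simp only [Pi.single_apply, smul_eq_mul, mul_ite, mul_one, mul_zero]
  by_cases hk : (m : ℤ) - k < 0 ∨ (p : ℤ) < m - k
  · rw [hF _ hk, mul_zero, map_zero, Finset.sum_eq_zero]
    intro l hl
    rw [Finset.mem_range] at hl
    rw [if_neg (by omega)]
  · rw [Finset.sum_eq_single ((m : ℤ) - k).toNat]
    · rw [if_pos (by omega), Int.toNat_of_nonneg (by omega)]
    · intro l _ hl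
      rw [if_neg (by omega)]
    · intro hl
      rw [Finset.mem_range] at hl
      omega

lemma deriv_theta_of_mem_Ioo (p : ℕ) {h : ℝ} (hh : 0 < h) (j e : ℤ) {x : ℝ}
    (hx : x ∈ Set.Ioo (0 : ℝ) 1) :
    deriv (theta (p + 1) h j) ((e + x) * h) = h⁻¹ * (dpiece (p + 1) (e - j)).eval x := by
  have hnhds : element h e ∈ 𝓝 ((e + x) * h) :=
    Icc_mem_nhds (mul_lt_mul_of_pos_right (by linarith [hx.1]) hh)
      (mul_lt_mul_of_pos_right (by linarith [hx.2]) hh)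
  rw [← derivWithin_of_mem_nhds hnhds,
    (isSplineWith_theta p hh j).derivWithin_eq hh e ⟨hx.1.le, hx.2.le⟩,
    sum_smul_single (fun _ => dpiece_eq_zero), smul_eq_mul]

lemma deriv_theta_eq_zero (p : ℕ) {h : ℝ} (hh : 0 < h) (j : ℤ) {t : ℝ}
    (ht : t < j * h ∨ ((j : ℝ) + (p + 1)) * h < t) : deriv (theta p h j) t = 0 := by
  have : theta p h j =ᶠ[𝓝 t] fun _ => 0 := by
    rcases ht with ht | ht
    · filter_upwards [Iio_mem_nhds ht] with u hu
      exact theta_eq_zero p hh j (Or.inl hu)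
    · filter_upwards [Ioi_mem_nhds ht] with u hu
      exact theta_eq_zero p hh j (Or.inr (le_of_lt hu))
  rw [this.deriv_eq, deriv_const]

lemma mass_eq_entry (p : ℕ) {h : ℝ} (hh : 0 < h) (j k : ℤ) :
    mass (p + 1) h j k = entry intFunctional (p + 1) (piece (p + 1)) k := by
  rw [mass, formB, integral_eq_sum_intFunctional hh j (p + 1)
    (f := fun m => piece (p + 1) m * piece (p + 1) (m - k)),
    sum_intFunctional_eq_entry (fun _ => piece_eq_zero), mul_div_cancel_left₀ _ hh.ne']
  · intro t ht
    rw [theta_eq_zero _ hh j (ht.imp_right le_of_lt), zero_mul]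
  · intro m _ x hx
    have e : (j + m + x : ℝ) = ((j + m : ℤ) : ℝ) + x := by push_cast; ring
    rw [e, theta_eq_piece p hh _ _ ⟨hx.1.le, hx.2.le⟩, theta_eq_piece p hh _ _ ⟨hx.1.le, hx.2.le⟩,
      eval_mul, add_sub_cancel_left, add_sub_add_left_eq_sub]

lemma stiff_eq_entry (p : ℕ) {h : ℝ} (hh : 0 < h) (j k : ℤ) :
    stiff (p + 1) h j k = entry intFunctional (p + 1) (dpiece (p + 1)) k := by
  rw [stiff, formA, integral_eq_sum_intFunctional hh j (p + 1)
    (f := fun m => (h⁻¹ * h⁻¹) • (dpiece (p + 1) m * dpiece (p + 1) (m - k)))]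
  · simp only [map_smul, ← Finset.smul_sum]
    rw [sum_intFunctional_eq_entry (fun _ => dpiece_eq_zero), smul_eq_mul]
    have := hh.ne'
    field_simp
  · intro t ht
    rw [deriv_theta_eq_zero _ hh j ht, zero_mul]
  · intro m _ x hx
    have e : (j + m + x : ℝ) = ((j + m : ℤ) : ℝ) + x := by push_cast; ring
    rw [e, deriv_theta_of_mem_Ioo p hh _ _ hx, deriv_theta_of_mem_Ioo p hh _ _ hx,
      eval_smul, eval_mul, add_sub_cancel_left, add_sub_add_left_eq_sub, smul_eq_mul]
    ring

/-! ### The blended rule and its parameter -/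

lemma sum_entry_eq_defect (L : ℝ[X] →ₗ[ℝ] ℝ) (p : ℕ) {r : ℕ} (hr : r ≠ 0) :
    ∑ k ∈ Finset.Icc 1 p,
      ((k : ℝ) ^ (2 * r + 2) / (Nat.factorial (2 * r + 2) : ℝ) * entry L p (dpiece p) k +
        (k : ℝ) ^ (2 * r) / (Nat.factorial (2 * r) : ℝ) * entry L p (piece p) k) =
      defect L p (2 * r) / 2 := by
  have h1 := sum_pow_mul_entry L p (dpiece p) (r := r + 1) (by omega)
  have h2 := sum_pow_mul_entry L p (piece p) hr
  rw [defect, show 2 * r + 2 = 2 * (r + 1) by ring, ← h1, ← h2, Finset.sum_add_distrib]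
  simp only [div_mul_eq_mul_div, ← Finset.sum_div]
  ring

lemma ruleFunctional_blend (p : ℕ) (Q : QuadRule) (τ : ℝ) : ruleFunctional (blend p Q τ) =
    τ • ruleFunctional (gaussRule (p + 1)) + (1 - τ) • ruleFunctional Q := by
  rw [blend, ruleFunctional_add, ruleFunctional_smul, ruleFunctional_smul]

section Blend

variable {Q : QuadRule} {q : ℕ}

lemma ruleFunctional_of_exactTo (hQ : Q.ExactTo (2 * (q + 1) - 2)) (f : ℝ[X])
    (hf : f.natDegree ≤ 2 * q) : ruleFunctional Q f = intFunctional f :=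
  hQ f (by omega)

lemma ruleFunctional_blend_of_exactTo (hQ : Q.ExactTo (2 * (q + 1) - 2)) (τ : ℝ) (f : ℝ[X])
    (hf : f.natDegree ≤ 2 * q) :
    ruleFunctional (blend (q + 1) Q τ) f = intFunctional f := by
  rw [ruleFunctional_blend, LinearMap.add_apply, LinearMap.smul_apply, LinearMap.smul_apply,
    gaussRule_exact (by omega), ruleFunctional_of_exactTo hQ f hf, ← add_smul, add_sub_cancel,
    one_smul]

/-- The rule with `q + 2` points is exact to degree `2 * q + 3`, beyond the degree `2 * q + 2` of
the products. -/
lemma corr_gaussRule {E : Type*} [AddCommGroup E] [Module ℝ E] {F : ℤ → ℝ[X]}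
    (hF : ∀ i, (F i).natDegree ≤ q + 1) (U : ℤ → E) :
    corr (ruleFunctional (gaussRule (q + 2))) (q + 1) F U = corr intFunctional (q + 1) F U :=
  corr_congr (d := 2 * q + 2) (fun _ hf => gaussRule_exact (by omega)) hF (by omega) U

lemma defect_blend (Q : QuadRule) (q : ℕ) (τ : ℝ) (r : ℕ) :
    defect (ruleFunctional (blend (q + 1) Q τ)) (q + 1) r =
      τ * defect intFunctional (q + 1) r + (1 - τ) * defect (ruleFunctional Q) (q + 1) r := by
  simp only [defect, moment, ruleFunctional_blend, corr_smul_add_smul, smul_eq_mul]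
  rw [corr_gaussRule (natDegree_piece_le (q + 1)),
    corr_gaussRule fun i => (natDegree_dpiece_le q i).trans q.le_succ]
  ring

lemma tauNum_eq (hn : Q.NodesInElement) {h : ℝ} (hh : 0 < h) (j : ℤ) :
    tauNum (q + 1) Q h j = defect (ruleFunctional Q) (q + 1) (2 * q + 2) / 2 := by
  rw [show 2 * q + 2 = 2 * (q + 1) by ring, ← sum_entry_eq_defect _ _ q.succ_ne_zero, tauNum]
  simp only [stiffQ_eq_entry hn hh, massQ_eq_entry hn hh]

lemma tauDen_eq (hn : Q.NodesInElement) {h : ℝ} (hh : 0 < h) (j : ℤ) :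
    tauDen (q + 1) Q h j = moment (ruleFunctional Q - intFunctional) (q + 1) (piece (q + 1))
      (2 * q + 2) / (Nat.factorial (2 * q + 2) : ℝ) / 2 := by
  rw [show 2 * q + 2 = 2 * (q + 1) by ring, ← sum_pow_mul_entry _ _ _ q.succ_ne_zero, tauDen]
  simp only [massQ_eq_entry hn hh, mass_eq_entry q hh, entry, corr_sub, div_mul_eq_mul_div,
    ← Finset.sum_div]
  ring

/-- A vanishing `errorFactor` would make every mass entry exact, against `hmass`; a nonvanishing one
keeps the moment of order `2 * q + 2` away from zero. -/
lemma tauDen_ne_zero (hn : Q.NodesInElement) (hQ : Q.ExactTo (2 * (q + 1) - 2))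
    (hmass : ∃ (h : ℝ) (j k : ℤ), 0 < h ∧ massQ (q + 1) Q h j k ≠ mass (q + 1) h j k)
    {h : ℝ} (hh : 0 < h) (j : ℤ) : tauDen (q + 1) Q h j ≠ 0 := by
  have hE := sub_intFunctional_eq_zero (ruleFunctional_of_exactTo hQ)
  have h0 : errorFactor (ruleFunctional Q - intFunctional) q ≠ 0 := by
    intro h0
    obtain ⟨h', j', k, hh', hne⟩ := hmass
    refine hne ?_
    rw [massQ_eq_entry hn hh', mass_eq_entry q hh', ← sub_eq_zero, entry, entry, ← corr_sub]
    exact entry_eq_zero_of_errorFactor hE h0 k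
  rw [tauDen_eq hn hh]
  have := moment_annihilates_piece_ne_zero hE h0
  positivity

/-- The blending parameter in terms of the moments of the rule. -/
noncomputable def blendParameter (Q : QuadRule) (q : ℕ) : ℝ :=
  defect (ruleFunctional Q) (q + 1) (2 * q + 2) /
    (moment (ruleFunctional Q - intFunctional) (q + 1) (piece (q + 1)) (2 * q + 2) /
      (Nat.factorial (2 * q + 2) : ℝ))

lemma tau_eq (hn : Q.NodesInElement) {h : ℝ} (hh : 0 < h) (j : ℤ) :
    tau (q + 1) Q h j = blendParameter Q q := by
  rw [tau, tauNum_eq hn hh, tauDen_eq hn hh, div_div_div_cancel_right₀ two_ne_zero, blendParameter]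

/-- The defect of the blend is that of `Q` minus `τ` times the difference of the defects of `Q` and
of exact integration. As the stiffness is exact, that difference is the mass-error moment in the
denominator of `τ`. -/
lemma defect_blend_blendParameter (hQ : Q.ExactTo (2 * (q + 1) - 2))
    (h0 : moment (ruleFunctional Q - intFunctional) (q + 1) (piece (q + 1)) (2 * q + 2) ≠ 0) :
    defect (ruleFunctional (blend (q + 1) Q (blendParameter Q q))) (q + 1) (2 * q + 2) = 0 := by
  have h1 : defect (ruleFunctional Q) (q + 1) (2 * q + 2) -
      defect intFunctional (q + 1) (2 * q + 2) =
      moment (ruleFunctional Q - intFunctional) (q + 1) (piece (q + 1)) (2 * q + 2) /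
        (Nat.factorial (2 * q + 2) : ℝ) := by
    rw [defect, defect, moment_dpiece_of_exact (ruleFunctional_of_exactTo hQ),
      moment_sub_intFunctional]
    ring
  have h2 : blendParameter Q q * (defect (ruleFunctional Q) (q + 1) (2 * q + 2) -
      defect intFunctional (q + 1) (2 * q + 2)) =
      defect (ruleFunctional Q) (q + 1) (2 * q + 2) := by
    rw [h1, blendParameter, div_mul_cancel₀]
    have : (Nat.factorial (2 * q + 2) : ℝ) ≠ 0 := by exact_mod_cast Nat.factorial_ne_zero _
    exact div_ne_zero h0 this
  rw [defect_blend]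
  linarith

lemma errorCoeff_eq (hn : Q.NodesInElement) (hQ : Q.ExactTo (2 * (q + 1) - 2)) {h : ℝ} (hh : 0 < h)
    (j : ℤ) : errorCoeff (q + 1) Q h j = (-1) ^ (q + 1) *
      defect (ruleFunctional (blend (q + 1) Q (blendParameter Q q))) (q + 1) (2 * q + 4) := by
  have hA : ∀ k : ℤ, entry (ruleFunctional Q) (q + 1) (dpiece (q + 1)) k =
      entry intFunctional (q + 1) (dpiece (q + 1)) k := fun k =>
    corr_congr (ruleFunctional_of_exactTo hQ) (natDegree_dpiece_le q) le_rfl _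
  have h1 := sum_entry_eq_defect intFunctional (q + 1) (r := q + 2) (by omega)
  have h2 := sum_entry_eq_defect (ruleFunctional Q) (q + 1) (r := q + 2) (by omega)
  simp only [hA] at h2
  rw [defect_blend, errorCoeff, tau_eq hn hh, show 2 * q + 4 = 2 * (q + 2) by ring,
    show 2 * (q + 1) + 4 = 2 * (q + 2) + 2 by ring, show 2 * (q + 1) + 2 = 2 * (q + 2) by ring,
    ← mul_div_cancel₀ (defect intFunctional (q + 1) (2 * (q + 2))) (two_ne_zero (α := ℝ)),
    ← mul_div_cancel₀ (defect (ruleFunctional Q) (q + 1) (2 * (q + 2))) (two_ne_zero (α := ℝ)),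
    ← h1, ← h2]
  simp only [stiff_eq_entry q hh, mass_eq_entry q hh, massQ_eq_entry hn hh]
  rw [mul_comm (2 : ℝ), mul_assoc]
  congr 1
  simp only [Finset.mul_sum, ← Finset.sum_add_distrib]
  refine Finset.sum_congr rfl fun k _ => ?_
  ring

end Blend

/-! ### Bloch waves and the eigenvalue error -/

section Bloch

lemma corr_mul_left (L : ℝ[X] →ₗ[ℝ] ℝ) (p : ℕ) (F : ℤ → ℝ[X]) (c : ℂ) (U : ℤ → ℂ) :
    corr L p F (fun k => c * U k) = c * corr L p F U := by
  simp only [corr, Finset.mul_sum, Complex.real_smul]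
  exact Finset.sum_congr rfl fun m _ => Finset.sum_congr rfl fun l _ => by ring

lemma corr_bloch (L : ℝ[X] →ₗ[ℝ] ℝ) (p : ℕ) (F : ℤ → ℝ[X]) (μ h : ℝ) (i : ℤ) :
    corr L p F (fun k => bloch μ h (i + k)) = bloch μ h i * symbol L p F (μ * h) := by
  rw [symbol, ← corr_mul_left]
  congr 1
  funext k
  rw [bloch, bloch, ← Complex.exp_add]
  congr 1
  push_cast
  ring

/-- Translation by `i` multiplies a Bloch wave by a nonzero constant, so all rows state one scalar
equation; `h ^ 2` is the ratio of the mass scaling `h` to the stiffness scaling `h⁻¹`. -/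
lemma isDiscreteEigenvalue_iff {Q : QuadRule} (hn : Q.NodesInElement) (q : ℕ) {h : ℝ} (hh : 0 < h)
    (μ lam : ℝ) : IsDiscreteEigenvalue (q + 1) Q h μ lam ↔
      symbol (ruleFunctional Q) (q + 1) (dpiece (q + 1)) (μ * h) =
        lam * h ^ 2 * symbol (ruleFunctional Q) (q + 1) (piece (q + 1)) (μ * h) := by
  have hne : ∀ i, bloch μ h i ≠ 0 := fun i => Complex.exp_ne_zero _
  have hh' : (h : ℂ) ≠ 0 := by exact_mod_cast hh.ne'
  have key : ∀ i : ℤ, (formAQ Q h (theta (q + 1) h i) (spline (q + 1) h (bloch μ h)) =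
      (lam : ℂ) * formBQ Q h (theta (q + 1) h i) (spline (q + 1) h (bloch μ h))) ↔
      symbol (ruleFunctional Q) (q + 1) (dpiece (q + 1)) (μ * h) =
        lam * h ^ 2 * symbol (ruleFunctional Q) (q + 1) (piece (q + 1)) (μ * h) := fun i => by
    have hs := isSplineWith_spline q hh (bloch μ h)
    rw [formAQ_eq_corr hn hh i hs, formBQ_eq_corr hn hh i hs, corr_bloch, corr_bloch,
      Complex.real_smul, Complex.real_smul, Complex.ofReal_inv,
      ← mul_right_inj' (mul_ne_zero hh' (inv_ne_zero (hne i)))]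
    have := hne i
    field_simp
  rw [IsDiscreteEigenvalue, IsEigenpair, forall_congr' key]
  simp only [forall_const, and_iff_right_iff_imp]
  exact fun _ h0 => hne 0 (congrFun h0 0)

variable {L : ℝ[X] →ₗ[ℝ] ℝ} {q : ℕ}

lemma tendsto_mul_nhdsGT (μ : ℝ) : Tendsto (fun h => μ * h) (𝓝[>] (0 : ℝ)) (𝓝 0) := by
  have : Continuous fun h : ℝ => μ * h := by fun_prop
  exact (this.tendsto' 0 0 (by simp)).mono_left nhdsWithin_le_nhds

lemma mul_pow_isBigO (μ : ℝ) (n : ℕ) :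
    (fun h : ℝ => (μ * h) ^ n) =O[𝓝[>] (0 : ℝ)] fun h => h ^ n := by
  simp only [mul_pow]
  exact Asymptotics.isBigO_const_mul_self _ _ _

lemma symbol_piece_sub_one_isBigO_mul
    (hL : ∀ f : ℝ[X], f.natDegree ≤ 2 * q → L f = intFunctional f) (μ : ℝ) :
    (fun h : ℝ => symbol L (q + 1) (piece (q + 1)) (μ * h) - 1) =O[𝓝[>] 0] fun h => h ^ 2 :=
  ((symbol_piece_sub_one_isBigO hL).comp_tendsto (tendsto_mul_nhdsGT μ)).trans (mul_pow_isBigO μ 2)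

lemma tendsto_symbol_piece (hL : ∀ f : ℝ[X], f.natDegree ≤ 2 * q → L f = intFunctional f) (μ : ℝ) :
    Tendsto (fun h : ℝ => symbol L (q + 1) (piece (q + 1)) (μ * h)) (𝓝[>] 0) (𝓝 1) := by
  have h2 : Tendsto (fun h : ℝ => h ^ 2) (𝓝[>] 0) (𝓝 0) :=
    ((continuous_pow 2).tendsto' 0 0 (by simp)).mono_left nhdsWithin_le_nhds
  simpa using ((symbol_piece_sub_one_isBigO_mul hL μ).trans_tendsto h2).add_const 1

/-- The error of the eigenvalue of a rule whose defect of order `2 * q + 2` is zero. -/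
lemma eigenvalue_error_isBigO (hL : ∀ f : ℝ[X], f.natDegree ≤ 2 * q → L f = intFunctional f)
    (h0 : defect L (q + 1) (2 * q + 2) = 0) (μ : ℝ) {lam : ℝ → ℝ}
    (hlam : ∀ᶠ h : ℝ in 𝓝[>] 0, symbol L (q + 1) (dpiece (q + 1)) (μ * h) =
        lam h * h ^ 2 * symbol L (q + 1) (piece (q + 1)) (μ * h)) :
    (fun h => lam h - μ ^ 2 - (-1) ^ (q + 1) * defect L (q + 1) (2 * q + 4) * μ ^ (2 * q + 6) *
      h ^ (2 * q + 4)) =O[𝓝[>] (0 : ℝ)] fun h => h ^ (2 * q + 6) := by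
  set C : ℝ := (-1) ^ (q + 1) * defect L (q + 1) (2 * q + 4) with hC
  set B : ℝ → ℂ := fun h => symbol L (q + 1) (piece (q + 1)) (μ * h) with hB
  have hB1 := symbol_piece_sub_one_isBigO_mul hL μ
  have hBt := tendsto_symbol_piece hL μ
  have hd := ((dispersion_isBigO hL h0).comp_tendsto (tendsto_mul_nhdsGT μ)).trans
    (mul_pow_isBigO μ (2 * q + 8))
  have hpow : (fun h : ℝ => (C : ℂ) * ((μ * h : ℝ) : ℂ) ^ (2 * q + 6)) =O[𝓝[>] (0 : ℝ)]
      fun h => h ^ (2 * q + 6) := by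
    refine Asymptotics.IsBigO.const_mul_left ?_ _
    refine Asymptotics.IsBigO.trans ?_ (mul_pow_isBigO μ (2 * q + 6))
    exact Asymptotics.IsBigO.of_bound 1 (Eventually.of_forall fun h => by simp)
  -- Replacing the leading term by its multiple with `B h` costs only `O(h ^ (2 * q + 8))`. Then `B
  -- h` is a common factor, and division by `B h * h ^ 2` isolates the eigenvalue error.
  have hnum := hd.sub ((hpow.mul hB1).congr_right fun h =>
    show h ^ (2 * q + 6) * h ^ 2 = h ^ (2 * q + 8) by ring)
  have hinv : (fun h : ℝ => (B h)⁻¹ * ((h : ℂ) ^ 2)⁻¹) =O[𝓝[>] (0 : ℝ)] fun h => (h ^ 2)⁻¹ := by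
    have h1 : (fun h : ℝ => (B h)⁻¹) =O[𝓝[>] (0 : ℝ)] fun _ => (1 : ℝ) :=
      (hBt.inv₀ one_ne_zero).isBigO_one ℝ
    have h2 : (fun h : ℝ => ((h : ℂ) ^ 2)⁻¹) =O[𝓝[>] (0 : ℝ)] fun h => (h ^ 2)⁻¹ :=
      Asymptotics.IsBigO.of_bound 1 (Eventually.of_forall fun h => by simp)
    simpa using h1.mul h2
  rw [← Complex.isBigO_ofReal_left]
  refine (hnum.mul hinv).congr' ?_ ?_
  · filter_upwards [hlam, hBt.eventually_ne one_ne_zero, self_mem_nhdsWithin] with h hl hne hpos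
    have hh : (h : ℂ) ≠ 0 := by exact_mod_cast (ne_of_gt hpos)
    have hne' : B h ≠ 0 := hne
    simp only [Function.comp_apply]
    rw [hl, hC]
    change (_ * B h - _ * B h - _ - _ * (B h - 1)) * _ = _
    push_cast
    field_simp
    ring
  · filter_upwards [self_mem_nhdsWithin] with h hpos
    have hh : h ≠ 0 := ne_of_gt hpos
    field_simp
    ring

/-- Both symbols are real by symmetry, and that of the mass tends to 1, so the scalar equation has
exactly one real solution for small `h`. -/
lemma existsUnique_eigenvalue (hL : ∀ f : ℝ[X], f.natDegree ≤ 2 * q → L f = intFunctional f)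
    (μ : ℝ) : ∀ᶠ h : ℝ in 𝓝[>] 0, ∃! lam : ℝ, symbol L (q + 1) (dpiece (q + 1)) (μ * h) =
        lam * h ^ 2 * symbol L (q + 1) (piece (q + 1)) (μ * h) := by
  filter_upwards [(tendsto_symbol_piece hL μ).eventually_ne one_ne_zero, self_mem_nhdsWithin]
    with h hne hpos
  have hh : h ≠ 0 := ne_of_gt hpos
  obtain ⟨a, ha⟩ : ∃ a : ℝ, symbol L (q + 1) (dpiece (q + 1)) (μ * h) = a :=
    ⟨_, (symbol_re_eq L (q + 1) (dpiece (q + 1)) (μ * h)).symm⟩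
  obtain ⟨b, hb⟩ : ∃ b : ℝ, symbol L (q + 1) (piece (q + 1)) (μ * h) = b :=
    ⟨_, (symbol_re_eq L (q + 1) (piece (q + 1)) (μ * h)).symm⟩
  rw [hb, Complex.ofReal_ne_zero] at hne
  rw [ha, hb]
  norm_cast
  refine ⟨a / (h ^ 2 * b), ?_, fun lam hlam => ?_⟩
  · beta_reduce
    field_simp
  · have hlam : a = lam * h ^ 2 * b := by exact_mod_cast hlam
    rw [hlam]
    field_simp

end Bloch

end IGA

open IGA in
theorem theorem5p2 (p : ℕ) (hp : 1 ≤ p) (Q : IGA.QuadRule)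
    (hnodes : Q.NodesInElement) (hexact : Q.ExactTo (2 * p - 2))
    (hmass : ∃ (h : ℝ) (j k : ℤ), 0 < h ∧ IGA.massQ p Q h j k ≠ IGA.mass p h j k)
    (j : ℤ) :
    (∀ h : ℝ, 0 < h → IGA.tauDen p Q h j ≠ 0) ∧
    (∀ h : ℝ, 0 < h → ∀ m ∈ Finset.Icc 2 (p + 1),
      ∑ k ∈ Finset.Icc 1 p,
        ((k : ℝ) ^ (2 * m) / (Nat.factorial (2 * m) : ℝ) *
            IGA.stiffQ p (IGA.blend p Q (IGA.tau p Q h j)) h j k +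
          (k : ℝ) ^ (2 * m - 2) / (Nat.factorial (2 * m - 2) : ℝ) *
            IGA.massQ p (IGA.blend p Q (IGA.tau p Q h j)) h j k) = 0) ∧
    ∀ μ : ℝ,
      (∀ᶠ h in 𝓝[>] (0 : ℝ),
        ∃! lam : ℝ, IGA.IsDiscreteEigenvalue p (IGA.blend p Q (IGA.tau p Q h j)) h μ lam) ∧
      ∀ lam : ℝ → ℝ,
        (∀ᶠ h in 𝓝[>] (0 : ℝ),
          IGA.IsDiscreteEigenvalue p (IGA.blend p Q (IGA.tau p Q h j)) h μ (lam h)) →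
        ((fun h => lam h - μ ^ 2 -
            IGA.errorCoeff p Q h j * μ ^ (2 * p + 4) * h ^ (2 * p + 2))
          =O[𝓝[>] (0 : ℝ)] fun h => h ^ (2 * p + 4)) ∧
        ((fun h => lam h - μ ^ 2) =O[𝓝[>] (0 : ℝ)] fun h => h ^ (2 * p + 2)) := by
  obtain ⟨q, rfl⟩ : ∃ q, p = q + 1 := ⟨p - 1, by omega⟩
  have hden : ∀ h : ℝ, 0 < h → tauDen (q + 1) Q h j ≠ 0 := fun h hh =>
    tauDen_ne_zero hnodes hexact hmass hh j
  have hmom : moment (ruleFunctional Q - intFunctional) (q + 1) (piece (q + 1))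
      (2 * q + 2) ≠ 0 := by
    intro h0
    have := hden 1 one_pos
    rw [tauDen_eq hnodes one_pos] at this
    exact this (by simpa using Or.inl h0)
  have hL := ruleFunctional_blend_of_exactTo hexact (blendParameter Q q)
  have hn := nodesInElement_blend (p := q + 1) hnodes (blendParameter Q q)
  have hdef := defect_blend_blendParameter hexact hmom
  refine ⟨hden, fun h hh m hm => ?_, fun μ => ⟨?_, fun lam hlam => ?_⟩⟩
  · rw [Finset.mem_Icc] at hm
    obtain ⟨r, rfl⟩ : ∃ r, m = r + 1 := ⟨m - 1, by omega⟩
    simp only [tau_eq hnodes hh, stiffQ_eq_entry hn hh, massQ_eq_entry hn hh]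
    have h1 := sum_entry_eq_defect (ruleFunctional (blend (q + 1) Q (blendParameter Q q))) (q + 1) (r := r) (by omega)
    rw [show 2 * (r + 1) - 2 = 2 * r by omega, show 2 * (r + 1) = 2 * r + 2 by ring]
    rw [h1, div_eq_zero_iff]
    left
    -- The orders `r ≤ q` vanish for every rule with this exactness; only the last one, `r = q + 1`,
    -- needs the choice of `τ`.
    rcases (show r ≤ q + 1 by omega).lt_or_eq with hr | rfl
    · exact defect_eq_zero hL (by omega)
    · exact hdef
  · filter_upwards [existsUnique_eigenvalue hL μ, self_mem_nhdsWithin] with h hex hpos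
    simpa only [tau_eq hnodes hpos, isDiscreteEigenvalue_iff hn q hpos] using hex
  · have hlam' : ∀ᶠ h : ℝ in 𝓝[>] 0,
        symbol (ruleFunctional (blend (q + 1) Q (blendParameter Q q))) (q + 1) (dpiece (q + 1)) (μ * h) =
        lam h * h ^ 2 *
          symbol (ruleFunctional (blend (q + 1) Q (blendParameter Q q))) (q + 1) (piece (q + 1)) (μ * h) := by
      filter_upwards [hlam, self_mem_nhdsWithin] with h hl hpos
      rwa [tau_eq hnodes hpos, isDiscreteEigenvalue_iff hn q hpos] at hl
    have hmain := eigenvalue_error_isBigO hL hdef μ hlam'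
    rw [show 2 * (q + 1) + 4 = 2 * q + 6 by ring, show 2 * (q + 1) + 2 = 2 * q + 4 by ring]
    refine ⟨hmain.congr' ?_ EventuallyEq.rfl, ?_⟩
    · filter_upwards [self_mem_nhdsWithin] with h hpos
      rw [errorCoeff_eq hnodes hexact hpos]
    · have h1 : (fun h : ℝ => h ^ (2 * q + 6)) =O[𝓝[>] (0 : ℝ)] fun h => h ^ (2 * q + 4) :=
        (Asymptotics.isLittleO_pow_pow (by omega)).isBigO.mono nhdsWithin_le_nhds
      refine ((hmain.trans h1).add (Asymptotics.isBigO_const_mul_self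
        ((-1) ^ (q + 1) * defect (ruleFunctional (blend (q + 1) Q (blendParameter Q q))) (q + 1) (2 * q + 4) *
          μ ^ (2 * q + 6)) (fun h : ℝ => h ^ (2 * q + 4)) _)).congr_left fun h => ?_
      ring
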